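/- **Corollary (Convergence of SWIFT under Uniform Client Influence).** *Problem.* Let $n\ge 2$ clients have uniform influence scores $p_i=1/n$. Let $\ell(x,\xi)$, $x\in\mathbb R^d$, be a measurable loss, differentiable in $x$, let $\mathcal D_i$ be the data distribution of client $i$, and put $f_i(x)=\mathbb E_{\xi\sim\mathcal D_i}\ell(x,\xi)$ (assumed to exist), $f=\sum_i p_if_i$. Assume: (1) each $f_i$ is differentiable and $\|\nabla f_i(x)-\nabla f_i(y)\|\le L\|x-y\|$; (2) $\mathbb E_{\xi\sim\mathcal D_i}\nabla\ell(x,\xi)=\nabla f_i(x)$; (3) for all $x$ and $i$, $\sum_j p_j\|\nabla f(x)-\nabla f_j(x)\|^2\le\zeta^2$ and $\mathbb E_{\xi\sim\mathcal D_i}\|\nabla f_i(x)-\nabla\ell(x,\xi)\|^2\le\sigma^2$, with $\sigma,\zeta\ge0$. Let $x^\star$ be a minimizer of $f$ and $\Delta_f=f(x^0)-f(x^\star)$. *Communication.* Let $\mathcal G_t$ be communication graphs on the clients such that, for some integer $B\ge1$, the union of the $\mathcal G_t$ over every window $kB\le t<(k+1)B$ is connected. Let $w^t_{j,i}\ge 0$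 be communication coefficients with $w^t_{j,i}=0$ unless $j=i$ or $j$ is a neighbour of $i$ in $\mathcal G_t$, $\sum_j w^t_{j,i}=1$ and $w^t_{i,i}\ge 1/n$. Each client has a counter, initially $1$, that increases by one each time the client is active, and the communication set is $\mathcal C_s=\{c : c \bmod (s+1)=0,\ c\le T\}$. Let $\tilde w^t_{j,i}=w^t_{j,i}$ if the counter of $i$ at iteration $t$ is in $\mathcal C_s$ and $\tilde w^t_{j,i}=\mathbf 1_{j=i}$ otherwise. Assume that for every iteration $t<T$ and every sequence of active clients the coefficients satisfy the symmetry condition $p_j\tilde w^t_{i,j}=p_i\tilde w^t_{j,i}$, and that some $\rho\in[0,1)$ satisfies $\max\{|\lambda_2|,|\lambda_n|\}\le\rho$ for the second largest and the smallest eigenvalue of $(\bar W^t)^\intercal\bar W^t$, where $\bar W^t=\sum_i p_i\,[I_n+(\tilde w^t_i-e_i)e_i^\intercal]$ and $\tilde w^t_i$ is the vector $(\tilde w^t_{j,i})_j$. (For $T\ge1$ this spectral condition at the first iteration entails $s=0$.) Put $\nu=(1-n^{-nB})^{1/B}$ and $$\rho_\nu=\frac{n-1}{n}\Big(\frac{7}{2(1-\rho)}+\frac{\sqrt\rho}{(1-\sqrt\rho)^2}+\frac{384}{1-\nu^2}\Big).$$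 *Algorithm.* SWIFT starts from $x^0_i=x^0$ for all $i$ and runs for $T$ iterations with batch size $M\ge1$ and step size $\gamma=\sqrt{Mn^2\Delta_f}/(\sqrt{TL}+\sqrt M)$. At iteration $t=0,\dots,T-1$, independently of the past, a client $i_t$ is drawn with probabilities $p$, and a batch of $M$ independent samples $\xi^t_m\sim\mathcal D_{i_t}$; then $$x^{t+1}_{i_t}=\sum_k\tilde w^t_{k,i_t}x^t_k-\frac{\gamma}{M}\sum_{m=1}^M\nabla\ell(x^t_{i_t},\xi^t_m),\qquad x^{t+1}_j=x^t_j\ (j\ne i_t).$$ Put $\bar x^t=\frac1n\sum_i x^t_i$. *Claim.* Here $p_{max}=\max_i p_i=1/n$, and the general iteration requirement $T\ge 193^2LM\Delta_f\rho_\nu^2n^4p_{max}^2$ becomes $$T\ge 193^2LM\Delta_f\rho_\nu^2\,n^2,$$ i.e. $T=\Omega(n^2)$. For fixed $L,M,\Delta_f,\rho_\nu$, the right-hand side is, as a function of $n\to\infty$, of smaller order than any requirement growing at least like $n^4$ (the order $T=\Omega(n^4)$ stated for AD-PSGD). Under this weaker requirement the following expectations are finite and $$\frac1T\sum_{t=0}^{T-1}\mathbb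 E\|\nabla f(\bar x^t)\|^2\le\frac{2\sqrt{\Delta_f}}{T}+\frac{2\sqrt{L\Delta_f}\big(1+\frac{1921}{20}\rho_\nu(\sigma^2+6M\zeta^2)\big)}{\sqrt{TM}}\le\frac{C}{\sqrt T},$$ where $C=2\sqrt{\Delta_f}+2\sqrt{L\Delta_f}\,\big(1+\frac{1921}{20}\rho_\nu(\sigma^2+6M\zeta^2)\big)/\sqrt M$. -/

import Mathlib

/-!
All counters start at `1`, so for `s ≠ 0` nobody averages at the first iteration: the expected
communication matrix is the identity, against the spectral condition. Hence `s = 0`, every active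
client averages, and the models form a Markov chain.

Its Lyapunov function is the suboptimality of the average model plus a multiple of the consensus
error `∑ i, ‖x i - average x‖ ^ 2`. The spectral condition bounds the Dirichlet form of the expected
communication matrix from below. As the diagonal coefficients are at least `1 / n`, this passes to
the coefficient matrices themselves, which therefore contract the consensus error. Together with the
smoothness of the objective, each iteration decreases the expectation of the Lyapunov function by
`γ / (2 n) * ‖∇f (average x)‖ ^ 2`, up to a noise term of order `γ ^ 2`; these inequalities are
summed over the iterations, and the step size balances the initial suboptimality and the noise.
-/

open MeasureTheory ProbabilityTheory Filter
open scoped BigOperators Gradient Matrix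

namespace Swift

/-- The space of models. -/
abbrev Model (d : ℕ) := EuclideanSpace ℝ (Fin d)

noncomputable section Objectives

variable {n d : ℕ} {Ξ : Type*} [MeasurableSpace Ξ]

/-- Local objective `f_i(x) = E_{ξ ∼ D_i} ℓ(x, ξ)`. -/
def localObjective (ℓ : Model d → Ξ → ℝ) (D : Fin n → Measure Ξ) (i : Fin n) (x : Model d) : ℝ :=
  ∫ ξ, ℓ x ξ ∂(D i)

/-- Global objective `f(x) = ∑ p_i f_i(x)`. -/
def globalObjective (p : Fin n → ℝ) (ℓ : Model d → Ξ → ℝ) (D : Fin n → Measure Ξ)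
    (x : Model d) : ℝ :=
  ∑ i, p i * localObjective ℓ D i x

/-- Gradient of the loss in the model variable. -/
def lossGradient (ℓ : Model d → Ξ → ℝ) (x : Model d) (ξ : Ξ) : Model d :=
  ∇ (fun y => ℓ y ξ) x

/-- The loss is measurable, differentiable in the model, and integrable over the local data, so
that the objectives and the stochastic gradients exist. -/
structure IsLoss (ℓ : Model d → Ξ → ℝ) (D : Fin n → Measure Ξ) : Prop where
  measurable : Measurable (Function.uncurry ℓ)
  differentiable : ∀ ξ, Differentiable ℝ (fun x => ℓ x ξ)
  integrable : ∀ i x, Integrable (ℓ x) (D i)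

/-- `h` is differentiable with `L`-Lipschitz gradient. -/
def IsSmooth (L : ℝ) (h : Model d → ℝ) : Prop :=
  Differentiable ℝ h ∧ ∀ x y, ‖∇ h x - ∇ h y‖ ≤ L * ‖x - y‖

/-- Unbiased stochastic gradients. -/
def UnbiasedGradient (ℓ : Model d → Ξ → ℝ) (D : Fin n → Measure Ξ) : Prop :=
  ∀ i x, Integrable (lossGradient ℓ x) (D i) ∧
    ∫ ξ, lossGradient ℓ x ξ ∂(D i) = ∇ (localObjective ℓ D i) x

/-- Bounded inter-client variance (constant `ζ`, client drawn from `p`) and bounded variance of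
the stochastic gradient within each client (constant `σ`). -/
structure BoundedVariance (p : Fin n → ℝ) (ℓ : Model d → Ξ → ℝ) (D : Fin n → Measure Ξ)
    (σ ζ : ℝ) : Prop where
  inter : ∀ x, ∑ i, p i * ‖∇ (globalObjective p ℓ D) x - ∇ (localObjective ℓ D i) x‖ ^ 2 ≤ ζ ^ 2
  intra_integrable : ∀ i x,
    Integrable (fun ξ => ‖∇ (localObjective ℓ D i) x - lossGradient ℓ x ξ‖ ^ 2) (D i)
  intra : ∀ i x, ∫ ξ, ‖∇ (localObjective ℓ D i) x - lossGradient ℓ x ξ‖ ^ 2 ∂(D i) ≤ σ ^ 2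

end Objectives

noncomputable section Communication

variable {n : ℕ}

/-- Communication set `C_s = {t : t mod (s+1) = 0, t ≤ T}`. -/
def commSet (s T : ℕ) : Set ℕ := {t | t % (s + 1) = 0 ∧ t ≤ T}

/-- Local update counters after the first `t` iterations, `a r` being the client which is active
at iteration `r`: all start at `1`, and the counter of the active client is increased. -/
def counter (a : ℕ → Fin n) : ℕ → Fin n → ℕ
  | 0 => fun _ => 1
  | t + 1 => Function.update (counter a t) (a t) (counter a t (a t) + 1)

/-- The weights `w j i` (weight given by client `i` to the model of client `j`) are client
communication coefficients for the graph `G`: nonnegative, supported on the closed neighbourhoods,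
with columns summing to one and diagonal at least `1 / n`. -/
structure IsCommWeights (G : SimpleGraph (Fin n)) (w : Fin n → Fin n → ℝ) : Prop where
  nonneg : ∀ j i, 0 ≤ w j i
  support : ∀ j i, w j i ≠ 0 → j = i ∨ G.Adj j i
  sum_eq_one : ∀ i, ∑ j, w j i = 1
  diag : ∀ i, 1 / (n : ℝ) ≤ w i i

open Classical in
/-- The coefficients in force at iteration `t`: those of `w t` for a client whose counter lies in
the communication set, those of no averaging for the others. -/
def activeCoeff (w : ℕ → Fin n → Fin n → ℝ) (s T : ℕ) (a : ℕ → Fin n) (t : ℕ)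
    (j i : Fin n) : ℝ :=
  if counter a t i ∈ commSet s T then w t j i else if j = i then 1 else 0

/-- Client communication matrix `I + (w_i - e_i) e_iᵀ` if client `i` is active. -/
def commMatrix (w : Fin n → Fin n → ℝ) (i : Fin n) : Matrix (Fin n) (Fin n) ℝ :=
  1 + Matrix.vecMulVec ((fun j => w j i) - Pi.single i 1) (Pi.single i 1)

/-- Expected client communication matrix `∑ p_i (I + (w_i - e_i) e_iᵀ)`. -/
def expectedCommMatrix (p : Fin n → ℝ) (w : Fin n → Fin n → ℝ) : Matrix (Fin n) (Fin n) ℝ :=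
  ∑ i, p i • commMatrix w i

/-- The `k`-th eigenvalue (counted from `0`, in decreasing order and with multiplicity) of the
real symmetric matrix `Aᵀ A`. -/
def gramEigenvalue (A : Matrix (Fin n) (Fin n) ℝ) (k : Fin n) : ℝ :=
  (show (Aᵀ * A).IsHermitian from Matrix.isHermitian_conjTranspose_mul_self A).eigenvalues₀
    (Fin.cast (Fintype.card_fin n).symm k)

/-- Uniform (`B`-)connectivity: over each window of `B` successive iterations the union of the
communication graphs is connected. -/
def UniformlyConnected (G : ℕ → SimpleGraph (Fin n)) (B : ℕ) : Prop :=
  0 < B ∧ ∀ k : ℕ, (⨆ t ∈ Set.Ico (k * B) ((k + 1) * B), G t).Connected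

/-- `ν = (1 - 1 / n^{nB})^{1/B}`. -/
def nu (n B : ℕ) : ℝ := (1 - 1 / (n : ℝ) ^ (n * B)) ^ (1 / (B : ℝ))

/-- The connectivity constant `ρ_ν`. -/
def rhoNu (n : ℕ) (ρ ν : ℝ) : ℝ :=
  ((n : ℝ) - 1) / n *
    (7 / (2 * (1 - ρ)) + √ρ / (1 - √ρ) ^ 2 + 384 / (1 - ν ^ 2))

end Communication

noncomputable section Algorithm

variable {n d M : ℕ} {Ξ : Type*}

/-- Mini-batch gradient `(1/M) ∑ ∇ℓ(x, ξ_m)`. -/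
def batchGradient (ℓ : Model d → Ξ → ℝ) (x : Model d) (ξ : Fin M → Ξ) : Model d :=
  (1 / (M : ℝ)) • ∑ m, lossGradient ℓ x (ξ m)

open Classical in
/-- The local models of SWIFT, for the activation sequence `a` and the mini-batches `b`. At
iteration `t` the active client `a t` averages the models of its neighbours if its counter lies in
the communication set, then takes a gradient step with the gradient computed at its model before
averaging; the other clients keep their models. -/
def models (ℓ : Model d → Ξ → ℝ) (w : ℕ → Fin n → Fin n → ℝ) (s T : ℕ) (γ : ℝ) (x0 : Model d)
    (a : ℕ → Fin n) (b : ℕ → Fin M → Ξ) : ℕ → Fin n → Model d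
  | 0 => fun _ => x0
  | t + 1 =>
    let x := models ℓ w s T γ x0 a b t
    let i := a t
    let half : Model d := if counter a t i ∈ commSet s T then ∑ k, w t k i • x k else x i
    Function.update x i (half - γ • batchGradient ℓ (x i) (b t))

/-- Average of the local models. -/
def average (x : Fin n → Model d) : Model d := (1 / (n : ℝ)) • ∑ i, x i

/-- Step size `√(M n² Δ) / (√(T L) + √M)`. -/
def stepSize (n M T : ℕ) (L Δ : ℝ) : ℝ :=
  √(M * (n : ℝ) ^ 2 * Δ) / (√(T * L) + √M)

/-- Number of iterations required of SWIFT for `n` clients with maximal influence `pmax`. -/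
def iterationRequirement (L M Δ r n pmax : ℝ) : ℝ :=
  193 ^ 2 * L * M * Δ * r ^ 2 * n ^ 4 * pmax ^ 2

variable [MeasurableSpace Ξ]

/-- Joint law of the active client and its mini-batch: the client is drawn from `p`, and given that
it is `i`, the batch consists of `M` independent samples of `D i`. -/
def stepLaw (M : ℕ) (p : Fin n → ℝ) (D : Fin n → Measure Ξ) : Measure (Fin n × (Fin M → Ξ)) :=
  ∑ i, ENNReal.ofReal (p i) • (Measure.dirac i).prod (Measure.pi fun _ : Fin M => D i)

/-- The active clients `act t` and their mini-batches `data t` are drawn as in SWIFT: independently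
over the iterations, and at each iteration with law `stepLaw`. -/
structure IsSampling {Ω : Type*} [MeasurableSpace Ω] (μ : Measure Ω) (p : Fin n → ℝ)
    (D : Fin n → Measure Ξ) (act : ℕ → Ω → Fin n) (data : ℕ → Ω → Fin M → Ξ) : Prop where
  measurable_act : ∀ t, Measurable (act t)
  measurable_data : ∀ t, Measurable (data t)
  indep : iIndepFun (fun t ω => (act t ω, data t ω)) μ
  law : ∀ t, μ.map (fun ω => (act t ω, data t ω)) = stepLaw M p D

end Algorithm

end Swift

namespace Swift

section Spectral

variable {E : Type*} [NormedAddCommGroup E] [InnerProductSpace ℝ E] [FiniteDimensional ℝ E]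
  {S : E →ₗ[ℝ] E} {N : ℕ} {ρ : ℝ} {e x : E}

theorem inner_apply_self_eq_sum_eigenvalues (hS : S.IsSymmetric)
    (hN : Module.finrank ℝ E = N) (x : E) :
    inner ℝ x (S x)
      = ∑ j, hS.eigenvalues hN j * inner ℝ (hS.eigenvectorBasis hN j) x ^ 2 := by
  rw [← (hS.eigenvectorBasis hN).sum_inner_mul_inner x (S x)]
  refine Finset.sum_congr rfl fun j _ => ?_
  rw [← hS, hS.apply_eigenvectorBasis, RCLike.ofReal_real_eq_id, id, real_inner_smul_left,
    real_inner_comm]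
  ring

theorem inner_eigenvectorBasis_eq_zero_of_apply_eq_self (hS : S.IsSymmetric)
    (hN : Module.finrank ℝ E = N) (he : S e = e) {j : Fin N} (hj : hS.eigenvalues hN j ≠ 1) :
    inner ℝ (hS.eigenvectorBasis hN j) e = 0 := by
  have h : inner ℝ (hS.eigenvectorBasis hN j) e
      = hS.eigenvalues hN j * inner ℝ (hS.eigenvectorBasis hN j) e := by
    conv_lhs => rw [← he, ← hS, hS.apply_eigenvectorBasis, RCLike.ofReal_real_eq_id, id,
      real_inner_smul_left]
  by_contra h0
  exact hj (mul_right_cancel₀ h0 (by rw [one_mul, ← h]))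

/-- All eigenvalues but the largest differ from `1`, so a fixed vector spans the first
eigendirection, and vectors orthogonal to it only see the other eigenvalues. -/
theorem inner_apply_self_le_of_second_eigenvalue_le (hS : S.IsSymmetric)
    (hN : Module.finrank ℝ E = N) {k : Fin N} (hk : (k : ℕ) = 1) (hρ1 : ρ < 1)
    (hρ : hS.eigenvalues hN k ≤ ρ) (he0 : e ≠ 0) (he : S e = e) (hx : inner ℝ e x = 0) :
    inner ℝ x (S x) ≤ ρ * ‖x‖ ^ 2 := by
  set b := hS.eigenvectorBasis hN
  let z : Fin N := ⟨0, by have := k.2; omega⟩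
  have eigenvalue_le : ∀ j ≠ z, hS.eigenvalues hN j ≤ ρ := fun j hj =>
    (hS.eigenvalues_antitone hN (by
      have : (j : ℕ) ≠ 0 := fun h => hj (Fin.ext h)
      rw [Fin.le_def]; omega)).trans hρ
  have fixed_eq : e = inner ℝ (b z) e • b z := by
    conv_lhs => rw [← b.sum_repr' e]
    refine Finset.sum_eq_single z (fun j _ hj => ?_) (by simp)
    rw [inner_eigenvectorBasis_eq_zero_of_apply_eq_self hS hN he
      ((eigenvalue_le j hj).trans_lt hρ1).ne, zero_smul]
  have inner_first : inner ℝ (b z) x = 0 := by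
    rw [fixed_eq, real_inner_smul_left] at hx
    refine (mul_eq_zero.1 hx).resolve_left fun h => he0 ?_
    rw [fixed_eq, h, zero_smul]
  rw [inner_apply_self_eq_sum_eigenvalues hS hN, ← b.sum_sq_norm_inner_right x, Finset.mul_sum]
  refine Finset.sum_le_sum fun j _ => ?_
  rw [Real.norm_eq_abs, sq_abs]
  rcases eq_or_ne j z with rfl | hj
  · simp only [b] at inner_first
    simp [b, inner_first]
  · exact mul_le_mul_of_nonneg_right (eigenvalue_le j hj) (sq_nonneg _)

variable {n : ℕ}

theorem dotProduct_mulVec_self_le_of_gramEigenvalue_le (hn : 2 ≤ n)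
    {A : Matrix (Fin n) (Fin n) ℝ} (hρ1 : ρ < 1)
    (hρ : gramEigenvalue A ⟨1, by omega⟩ ≤ ρ) (hA : (Aᵀ * A) *ᵥ 1 = 1) {z : Fin n → ℝ}
    (hz : ∑ i, z i = 0) :
    (A *ᵥ z) ⬝ᵥ (A *ᵥ z) ≤ ρ * (z ⬝ᵥ z) := by
  have hS := Matrix.isSymmetric_toEuclideanLin_iff.mpr
    (show (Aᵀ * A).IsHermitian from Matrix.isHermitian_conjTranspose_mul_self A)
  have h := inner_apply_self_le_of_second_eigenvalue_le hS finrank_euclideanSpace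
    (k := Fin.cast (Fintype.card_fin n).symm ⟨1, by omega⟩) rfl hρ1 hρ
    (e := WithLp.toLp 2 1) (x := WithLp.toLp 2 z) (fun h0 => ?_) ?_ ?_
  · rw [← real_inner_self_eq_norm_sq] at h
    simpa only [Matrix.toLpLin_toLp, Matrix.toLin'_apply, EuclideanSpace.inner_toLp_toLp,
      star_trivial, dotProduct_comm _ z, ← Matrix.mulVec_mulVec, Matrix.dotProduct_mulVec,
      Matrix.vecMul_transpose] using h
  · simpa using congrArg (fun v : EuclideanSpace ℝ (Fin n) => v ⟨0, by omega⟩) h0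
  · rw [Matrix.toLpLin_toLp, Matrix.toLin'_apply, hA]
  · simp [EuclideanSpace.inner_toLp_toLp, dotProduct, hz]

theorem gramEigenvalue_one (k : Fin n) : gramEigenvalue (1 : Matrix (Fin n) (Fin n) ℝ) k = 1 := by
  have hS := Matrix.isSymmetric_toEuclideanLin_iff.mpr
    (show ((1 : Matrix (Fin n) (Fin n) ℝ)ᵀ * 1).IsHermitian from
      Matrix.isHermitian_conjTranspose_mul_self 1)
  let b := hS.eigenvectorBasis finrank_euclideanSpace
  let j := Fin.cast (Fintype.card_fin n).symm k
  have h : b j = gramEigenvalue 1 k • b j :=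
    (by simp : b j = Matrix.toEuclideanLin (1ᵀ * 1) (b j)).trans
      (hS.apply_eigenvectorBasis finrank_euclideanSpace j)
  exact (smul_left_injective ℝ (b.orthonormal.ne_zero j) (by simpa using h)).symm

end Spectral

section Mixing

section Dirichlet

variable {ι : Type*} [Fintype ι]

theorem sum_mul_sq_sub_eq {W : Matrix ι ι ℝ} (hrow : ∀ i, ∑ j, W i j = 1)
    (hcol : ∀ j, ∑ i, W i j = 1) (z : ι → ℝ) :
    ∑ i, ∑ j, W i j * (z i - z j) ^ 2 = 2 * (z ⬝ᵥ z - z ⬝ᵥ (W *ᵥ z)) := by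
  have left_square : ∑ i, ∑ j, W i j * (z i * z i) = z ⬝ᵥ z := by
    simp only [← Finset.sum_mul, hrow, one_mul, dotProduct]
  have right_square : ∑ i, ∑ j, W i j * (z j * z j) = z ⬝ᵥ z := by
    rw [Finset.sum_comm]
    simp only [← Finset.sum_mul, hcol, one_mul, dotProduct]
  have cross : ∑ i, ∑ j, W i j * (z i * z j) = z ⬝ᵥ (W *ᵥ z) := by
    simp only [dotProduct, Matrix.mulVec, Finset.mul_sum]
    exact Finset.sum_congr rfl fun i _ => Finset.sum_congr rfl fun j _ => by ring
  have expand (i j : ι) : W i j * (z i - z j) ^ 2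
      = W i j * (z i * z i) + W i j * (z j * z j) - 2 * (W i j * (z i * z j)) := by ring
  simp only [expand, Finset.sum_add_distrib, Finset.sum_sub_distrib, ← Finset.mul_sum,
    left_square, right_square, cross]
  ring

variable [DecidableEq ι]

/-- The off-diagonal entry `(i, j)` of `Wᵀ W` is at least `W i i * W i j + W j i * W j j`, so the
Dirichlet form of `Wᵀ W` dominates `2 c` times the one of `W`. -/
theorem two_mul_dirichlet_le_of_mem_doublyStochastic {W : Matrix ι ι ℝ}
    (hW : W ∈ doublyStochastic ℝ ι) {c : ℝ} (hdiag : ∀ i, c ≤ W i i) (z : ι → ℝ) :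
    2 * c * (z ⬝ᵥ z - z ⬝ᵥ (W *ᵥ z)) ≤ z ⬝ᵥ z - (W *ᵥ z) ⬝ᵥ (W *ᵥ z) := by
  have hgram : Wᵀ * W ∈ doublyStochastic ℝ ι :=
    mul_mem (transpose_mem_doublyStochastic_iff.2 hW) hW
  have nonneg (i j : ι) : 0 ≤ W i j := nonneg_of_mem_doublyStochastic hW
  have entry_le (i j : ι) : c * (W i j + W j i) * (z i - z j) ^ 2
      ≤ (Wᵀ * W) i j * (z i - z j) ^ 2 := by
    rcases eq_or_ne i j with rfl | hij
    · simp
    refine mul_le_mul_of_nonneg_right ?_ (sq_nonneg _)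
    calc c * (W i j + W j i) ≤ W i i * W i j + W j i * W j j := by
          nlinarith [mul_le_mul_of_nonneg_right (hdiag i) (nonneg i j),
            mul_le_mul_of_nonneg_right (hdiag j) (nonneg j i)]
      _ = ∑ k ∈ {i, j}, W k i * W k j :=
          (Finset.sum_pair (f := fun k => W k i * W k j) hij).symm
      _ ≤ (Wᵀ * W) i j := Finset.sum_le_sum_of_subset_of_nonneg (Finset.subset_univ _)
          fun k _ _ => mul_nonneg (nonneg k i) (nonneg k j)
  have swap : ∑ i, ∑ j, W j i * (z i - z j) ^ 2 = ∑ i, ∑ j, W i j * (z i - z j) ^ 2 := by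
    rw [Finset.sum_comm]
    simp only [sub_sq_comm]
  have dirichlet_eq := sum_mul_sq_sub_eq (sum_row_of_mem_doublyStochastic hW)
    (sum_col_of_mem_doublyStochastic hW) z
  have dirichlet_gram_eq := sum_mul_sq_sub_eq (sum_row_of_mem_doublyStochastic hgram)
    (sum_col_of_mem_doublyStochastic hgram) z
  rw [← Matrix.mulVec_mulVec, Matrix.dotProduct_mulVec, Matrix.vecMul_transpose]
    at dirichlet_gram_eq
  have dirichlet_le := Finset.sum_le_sum fun i (_ : i ∈ Finset.univ) =>
    Finset.sum_le_sum fun j (_ : j ∈ Finset.univ) => entry_le i j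
  simp only [mul_assoc c, ← Finset.mul_sum, add_mul, Finset.sum_add_distrib, swap, dirichlet_eq,
    dirichlet_gram_eq] at dirichlet_le
  linarith

end Dirichlet

variable {n : ℕ}

theorem expectedCommMatrix_eq (p : Fin n → ℝ) (w : Fin n → Fin n → ℝ) :
    expectedCommMatrix p w
      = (∑ i, p i) • 1 + (Matrix.of w - 1) * Matrix.diagonal p := by
  ext j k
  simp [expectedCommMatrix, commMatrix, Matrix.sum_apply, Matrix.vecMulVec_apply,
    Pi.single_apply, Matrix.one_apply, Finset.sum_add_distrib, Matrix.sub_apply,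
    mul_comm]

theorem expectedCommMatrix_uniform [NeZero n] {p : Fin n → ℝ} (hp : ∀ i, p i = 1 / (n : ℝ))
    (w : Fin n → Fin n → ℝ) :
    expectedCommMatrix p w = (1 - 1 / (n : ℝ)) • 1 + (1 / (n : ℝ)) • Matrix.of w := by
  have hn0 : (n : ℝ) ≠ 0 := NeZero.ne _
  obtain rfl : p = fun _ => 1 / (n : ℝ) := funext hp
  rw [expectedCommMatrix_eq, ← Matrix.smul_eq_mul_diagonal]
  simp [hn0, sub_smul, smul_sub]
  abel

/-- Averaging with the coefficients `W`, in which client `i` gives weight `W k i` to client `k`,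
keeps the average of the models and contracts the squared deviations from it by `1 - 2 κ`. -/
structure IsMixing (κ : ℝ) (W : Matrix (Fin n) (Fin n) ℝ) : Prop where
  mem_doublyStochastic : W ∈ doublyStochastic ℝ (Fin n)
  contraction : ∀ z : Fin n → ℝ, ∑ i, z i = 0 →
    (z ᵥ* W) ⬝ᵥ (z ᵥ* W) ≤ (1 - 2 * κ) * (z ⬝ᵥ z)

theorem isMixing_of_gramEigenvalue_le (hn : 2 ≤ n) {p : Fin n → ℝ}
    (hp : ∀ i, p i = 1 / (n : ℝ)) {w : Fin n → Fin n → ℝ}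
    (hw : Matrix.of w ∈ doublyStochastic ℝ (Fin n)) (hdiag : ∀ i, 1 / (n : ℝ) ≤ w i i) {ρ : ℝ}
    (hρ0 : 0 ≤ ρ) (hρ1 : ρ < 1)
    (hρ : gramEigenvalue (expectedCommMatrix p w) ⟨1, by omega⟩ ≤ ρ) :
    IsMixing (1 - √ρ) (Matrix.of w) := by
  refine ⟨hw, fun z hz => ?_⟩
  have : NeZero n := ⟨by omega⟩
  have inv_le_one : 1 / (n : ℝ) ≤ 1 := by
    rw [div_le_one (by positivity)]; exact_mod_cast one_le_two.trans hn
  set A := expectedCommMatrix p w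
  have hA : A = (1 - 1 / (n : ℝ)) • 1 + (1 / (n : ℝ)) • Matrix.of w :=
    expectedCommMatrix_uniform hp w
  have hA_mem : A ∈ doublyStochastic ℝ (Fin n) := by
    rw [hA]
    exact convex_doublyStochastic (one_mem _) hw (by linarith) (by positivity) (by ring)
  have gram_le : (A *ᵥ z) ⬝ᵥ (A *ᵥ z) ≤ ρ * (z ⬝ᵥ z) :=
    dotProduct_mulVec_self_le_of_gramEigenvalue_le hn hρ1 hρ (mulVec_one_of_mem_doublyStochastic
      (mul_mem (transpose_mem_doublyStochastic_iff.2 hA_mem) hA_mem)) hz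
  have inner_le : z ⬝ᵥ (A *ᵥ z) ≤ √ρ * (z ⬝ᵥ z) := by
    have hz0 : 0 ≤ z ⬝ᵥ z := Finset.sum_nonneg fun i _ => mul_self_nonneg (z i)
    refine le_of_sq_le_sq ?_ (by positivity)
    calc (z ⬝ᵥ (A *ᵥ z)) ^ 2 ≤ (z ⬝ᵥ z) * ((A *ᵥ z) ⬝ᵥ (A *ᵥ z)) := by
          simpa only [dotProduct, sq] using
            Finset.sum_mul_sq_le_sq_mul_sq Finset.univ z (A *ᵥ z)
      _ ≤ (z ⬝ᵥ z) * (ρ * (z ⬝ᵥ z)) := mul_le_mul_of_nonneg_left gram_le hz0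
      _ = (√ρ * (z ⬝ᵥ z)) ^ 2 := by rw [mul_pow, Real.sq_sqrt hρ0]; ring
  have dirichlet_le := two_mul_dirichlet_le_of_mem_doublyStochastic
    (transpose_mem_doublyStochastic_iff.2 hw) (c := 1 / (n : ℝ)) hdiag z
  rw [Matrix.mulVec_transpose, dotProduct_comm z (z ᵥ* _), ← Matrix.dotProduct_mulVec]
    at dirichlet_le
  rw [hA, Matrix.add_mulVec, Matrix.smul_mulVec, Matrix.smul_mulVec, Matrix.one_mulVec,
    dotProduct_add, dotProduct_smul, dotProduct_smul, smul_eq_mul, smul_eq_mul] at inner_le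
  linarith

theorem IsMixing.sum_norm_sq_le {E : Type*} [NormedAddCommGroup E] [InnerProductSpace ℝ E]
    [FiniteDimensional ℝ E] {κ : ℝ} {W : Matrix (Fin n) (Fin n) ℝ} (hW : IsMixing κ W)
    {y : Fin n → E} (hy : ∑ i, y i = 0) :
    ∑ i, ‖∑ k, W k i • y k‖ ^ 2 ≤ (1 - 2 * κ) * ∑ i, ‖y i‖ ^ 2 := by
  let b := stdOrthonormalBasis ℝ E
  simp only [← b.sum_sq_norm_inner_right, Real.norm_eq_abs, sq_abs]
  rw [Finset.sum_comm, Finset.sum_comm (f := fun i j => inner ℝ (b j) (y i) ^ 2), Finset.mul_sum]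
  refine Finset.sum_le_sum fun j _ => ?_
  have h := hW.contraction (fun i => inner ℝ (b j) (y i))
    (by rw [← inner_sum, hy, inner_zero_right])
  simpa only [dotProduct, Matrix.vecMul, inner_sum, real_inner_smul_right, mul_comm, ← sq] using h

end Mixing

section NormedGroup

variable {E : Type*} [SeminormedAddCommGroup E]

theorem norm_add_add_sq_le (a b c : E) :
    ‖a + b + c‖ ^ 2 ≤ 3 * ‖a‖ ^ 2 + 3 * ‖b‖ ^ 2 + 3 * ‖c‖ ^ 2 :=
  calc ‖a + b + c‖ ^ 2 ≤ (‖a‖ + ‖b‖ + ‖c‖) ^ 2 := by gcongr; exact norm_add₃_le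
    _ ≤ 3 * ‖a‖ ^ 2 + 3 * ‖b‖ ^ 2 + 3 * ‖c‖ ^ 2 := by
      nlinarith [sq_nonneg (‖a‖ - ‖b‖), sq_nonneg (‖a‖ - ‖c‖), sq_nonneg (‖b‖ - ‖c‖)]

theorem norm_sum_sq_le_card_mul {ι : Type*} [Fintype ι] (y : ι → E) :
    ‖∑ i, y i‖ ^ 2 ≤ Fintype.card ι * ∑ i, ‖y i‖ ^ 2 :=
  calc ‖∑ i, y i‖ ^ 2 ≤ (∑ i, ‖y i‖) ^ 2 := by gcongr; exact norm_sum_le _ _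
    _ ≤ Fintype.card ι * ∑ i, ‖y i‖ ^ 2 := sq_sum_le_card_mul_sum_sq

end NormedGroup

section InnerProductSpace

variable {E : Type*} [NormedAddCommGroup E] [InnerProductSpace ℝ E]

theorem le_add_inner_gradient_add_norm_sq [CompleteSpace E] {L : ℝ} {f : E → ℝ}
    (hf : Differentiable ℝ f) (hL : ∀ x y, ‖∇ f x - ∇ f y‖ ≤ L * ‖x - y‖) (x v : E) :
    f (x + v) ≤ f x + inner ℝ (∇ f x) v + L / 2 * ‖v‖ ^ 2 := by
  let φ : ℝ → ℝ := fun t => f (x + t • v) - t * inner ℝ (∇ f x) v - L / 2 * t ^ 2 * ‖v‖ ^ 2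
  have hasDerivAt_φ (t : ℝ) : HasDerivAt φ
      (inner ℝ (∇ f (x + t • v)) v - inner ℝ (∇ f x) v - L * t * ‖v‖ ^ 2) t := by
    have line : HasDerivAt (fun t : ℝ => x + t • v) v t := by
      simpa using ((hasDerivAt_id t).smul_const v).const_add x
    have f_line := ((hf (x + t • v)).hasGradientAt.hasFDerivAt).comp_hasDerivAt t line
    refine ((f_line.sub ((hasDerivAt_id t).mul_const (inner ℝ (∇ f x) v))).sub
      (((hasDerivAt_pow 2 t).const_mul (L / 2)).mul_const (‖v‖ ^ 2))).congr_deriv ?_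
    rw [InnerProductSpace.toDual_apply_apply]
    push_cast
    ring
  have antitone_φ : AntitoneOn φ (Set.Icc 0 1) := by
    refine antitoneOn_of_deriv_nonpos (convex_Icc 0 1)
      (fun t _ => (hasDerivAt_φ t).continuousAt.continuousWithinAt)
      (fun t _ => (hasDerivAt_φ t).differentiableAt.differentiableWithinAt) fun t ht => ?_
    rw [interior_Icc] at ht
    rw [(hasDerivAt_φ t).deriv, ← inner_sub_left, sub_nonpos]
    calc inner ℝ (∇ f (x + t • v) - ∇ f x) v ≤ ‖∇ f (x + t • v) - ∇ f x‖ * ‖v‖ :=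
          real_inner_le_norm _ _
      _ ≤ L * ‖x + t • v - x‖ * ‖v‖ := by gcongr; exact hL _ _
      _ = L * t * ‖v‖ ^ 2 := by
          rw [add_sub_cancel_left, norm_smul, Real.norm_eq_abs, abs_of_pos ht.1]; ring
  have := antitone_φ (Set.left_mem_Icc.2 zero_le_one) (Set.right_mem_Icc.2 zero_le_one) zero_le_one
  simp only [φ, one_smul, zero_smul, add_zero] at this
  linarith

theorem norm_sub_sq_le_young {κ : ℝ} (hκ : 0 < κ) (u v : E) :
    ‖u - v‖ ^ 2 ≤ (1 + κ) * ‖u‖ ^ 2 + (1 + 1 / κ) * ‖v‖ ^ 2 := by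
  have cross : 2 * (‖u‖ * ‖v‖) ≤ κ * ‖u‖ ^ 2 + 1 / κ * ‖v‖ ^ 2 := by
    have h : κ * (‖u‖ - 1 / κ * ‖v‖) ^ 2
        = κ * ‖u‖ ^ 2 + 1 / κ * ‖v‖ ^ 2 - 2 * (‖u‖ * ‖v‖) := by field_simp; ring
    linarith [show 0 ≤ κ * (‖u‖ - 1 / κ * ‖v‖) ^ 2 by positivity]
  rw [norm_sub_sq_real]
  linarith [neg_le_of_abs_le (abs_real_inner_le_norm u v)]

theorem three_quarters_mul_norm_sq_sub_le_inner (a b : E) :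
    3 / 4 * ‖a‖ ^ 2 - ‖a - b‖ ^ 2 ≤ inner ℝ a b := by
  have polarization := norm_sub_sq_real a b
  have young := norm_sub_sq_le_young one_pos (a - b) (-b)
  rw [sub_neg_eq_add, sub_add_cancel, norm_neg] at young
  linarith

end InnerProductSpace

section Dispersion

variable {n d : ℕ}

/-- Consensus error: the sum of the squared distances of the models to their average. -/
noncomputable def dispersion (x : Fin n → Model d) : ℝ := ∑ j, ‖x j - average x‖ ^ 2

theorem dispersion_nonneg (x : Fin n → Model d) : 0 ≤ dispersion x :=
  Finset.sum_nonneg fun _ _ => sq_nonneg _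

theorem average_const [NeZero n] (x : Model d) : average (fun _ : Fin n => x) = x := by
  have hn0 : (n : ℝ) ≠ 0 := NeZero.ne _
  simp [average, hn0, ← Nat.cast_smul_eq_nsmul ℝ, smul_smul]

theorem dispersion_const [NeZero n] (x : Model d) : dispersion (fun _ : Fin n => x) = 0 := by
  simp [dispersion, average_const]

theorem average_sub (x y : Fin n → Model d) :
    average (fun i => x i - y i) = average x - average y := by
  simp only [average, Finset.sum_sub_distrib, smul_sub]

theorem average_update (x : Fin n → Model d) (i : Fin n) (v : Model d) :
    average (Function.update x i (x i + v)) = average x + (1 / (n : ℝ)) • v := by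
  rw [average, average, ← smul_add, Finset.sum_update_of_mem (Finset.mem_univ i),
    ← Finset.add_sum_erase _ _ (Finset.mem_univ i), Finset.sdiff_singleton_eq_erase]
  congr 1
  abel

/-- Lyapunov function of the convergence proof: the suboptimality of the average model with
respect to `fmin`, plus `β` times the consensus error. -/
noncomputable def potential (f : Model d → ℝ) (fmin β : ℝ) (x : Fin n → Model d) : ℝ :=
  f (average x) - fmin + β * dispersion x

theorem potential_nonneg {f : Model d → ℝ} {fmin β : ℝ} (hfmin : ∀ x, fmin ≤ f x) (hβ : 0 ≤ β)
    (x : Fin n → Model d) : 0 ≤ potential f fmin β x :=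
  add_nonneg (sub_nonneg.2 (hfmin _)) (mul_nonneg hβ (dispersion_nonneg x))

variable [NeZero n]

theorem sum_eq_smul_average (x : Fin n → Model d) : ∑ i, x i = (n : ℝ) • average x := by
  rw [average, smul_smul, mul_one_div_cancel (NeZero.ne _), one_smul]

theorem sum_sub_average (x : Fin n → Model d) : ∑ j, (x j - average x) = 0 := by
  simp [sum_eq_smul_average x, Nat.cast_smul_eq_nsmul]

theorem norm_average_sq_le (y : Fin n → Model d) :
    ‖average y‖ ^ 2 ≤ 1 / n * ∑ i, ‖y i‖ ^ 2 := by
  have hn0 : (n : ℝ) ≠ 0 := NeZero.ne _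
  have h : ‖∑ i, y i‖ ^ 2 ≤ n * ∑ i, ‖y i‖ ^ 2 := by simpa using norm_sum_sq_le_card_mul y
  calc ‖average y‖ ^ 2 = (1 / (n : ℝ)) ^ 2 * ‖∑ i, y i‖ ^ 2 := by
        rw [average, norm_smul, mul_pow, Real.norm_eq_abs, sq_abs]
    _ ≤ (1 / (n : ℝ)) ^ 2 * (n * ∑ i, ‖y i‖ ^ 2) := by gcongr
    _ = 1 / n * ∑ i, ‖y i‖ ^ 2 := by field_simp

theorem dispersion_le_sum_norm_sq_sub (x : Fin n → Model d) (c : Model d) :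
    dispersion x ≤ ∑ j, ‖x j - c‖ ^ 2 := by
  have expand (j : Fin n) : ‖x j - c‖ ^ 2 = ‖x j - average x‖ ^ 2
      + 2 * inner ℝ (x j - average x) (average x - c) + ‖average x - c‖ ^ 2 := by
    rw [← norm_add_sq_real, sub_add_sub_cancel]
  simp only [expand, Finset.sum_add_distrib, ← Finset.mul_sum, ← sum_inner, sum_sub_average,
    inner_zero_left, mul_zero, add_zero]
  exact le_add_of_nonneg_right (Finset.sum_nonneg fun _ _ => sq_nonneg _)

theorem dispersion_update_le (x : Fin n → Model d) (i : Fin n) (v : Model d) :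
    dispersion (Function.update x i (x i + v))
      ≤ dispersion x + 2 * inner ℝ (x i - average x) v + ‖v‖ ^ 2 := by
  refine (dispersion_le_sum_norm_sq_sub _ (average x)).trans_eq ?_
  have unchanged : ∑ j ∈ Finset.univ.erase i, ‖Function.update x i (x i + v) j - average x‖ ^ 2
      = ∑ j ∈ Finset.univ.erase i, ‖x j - average x‖ ^ 2 :=
    Finset.sum_congr rfl fun j hj => by rw [Function.update_of_ne (Finset.ne_of_mem_erase hj)]
  rw [dispersion, ← Finset.add_sum_erase _ _ (Finset.mem_univ i), unchanged,
    ← Finset.add_sum_erase _ (fun j => ‖x j - average x‖ ^ 2) (Finset.mem_univ i),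
    Function.update_self, add_sub_right_comm, norm_add_sq_real]
  ring

theorem potential_update_le {L β fmin : ℝ} (hβ : 0 ≤ β) {f : Model d → ℝ} (hf : IsSmooth L f)
    (x : Fin n → Model d) (i : Fin n) (v : Model d) :
    potential f fmin β (Function.update x i (x i + v))
      ≤ potential f fmin β x
        + inner ℝ ((1 / (n : ℝ)) • ∇ f (average x) + (2 * β) • (x i - average x)) v
        + (L / (2 * n ^ 2) + β) * ‖v‖ ^ 2 := by
  have descent := le_add_inner_gradient_add_norm_sq hf.1 hf.2 (average x) ((1 / (n : ℝ)) • v)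
  rw [← average_update x i v, real_inner_smul_right, norm_smul, mul_pow, Real.norm_eq_abs, sq_abs]
    at descent
  have spread := mul_le_mul_of_nonneg_left (dispersion_update_le x i v) hβ
  have hn0 : (n : ℝ) ≠ 0 := NeZero.ne _
  have coeff : L / 2 * ((1 / (n : ℝ)) ^ 2 * ‖v‖ ^ 2) = L / (2 * n ^ 2) * ‖v‖ ^ 2 := by field_simp
  rw [potential, potential, inner_add_left, real_inner_smul_left, real_inner_smul_left]
  linarith

end Dispersion

section Drift

variable {n d : ℕ} {W : Matrix (Fin n) (Fin n) ℝ} {γ κ L ζ : ℝ} {x g h : Fin n → Model d}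

/-- Mean displacement of client `i`, if it is active: it averages the models `x` with the
coefficients `W`, then takes a step of size `γ` along `-g i`, where `g i` stands for the mean of its
stochastic gradient. -/
noncomputable def drift (W : Matrix (Fin n) (Fin n) ℝ) (γ : ℝ) (x g : Fin n → Model d)
    (i : Fin n) : Model d :=
  ∑ k, W k i • x k - x i - γ • g i

theorem drift_eq_deviations (hW : W ∈ doublyStochastic ℝ (Fin n)) (i : Fin n) :
    drift W γ x g i
      = ∑ k, W k i • (x k - average x) - (x i - average x) - γ • g i := by
  simp only [drift, smul_sub, Finset.sum_sub_distrib, ← Finset.sum_smul,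
    sum_col_of_mem_doublyStochastic hW, one_smul, sub_sub_sub_cancel_right]

variable [NeZero n]

theorem sum_drift (hW : W ∈ doublyStochastic ℝ (Fin n)) :
    ∑ i, drift W γ x g i = -((γ * n) • average g) := by
  have averaging : ∑ i, ∑ k, W k i • x k = ∑ i, x i := by
    rw [Finset.sum_comm]
    simp only [← Finset.sum_smul, sum_row_of_mem_doublyStochastic hW, one_smul]
  simp only [drift, Finset.sum_sub_distrib, averaging, sub_self, zero_sub, ← Finset.smul_sum,
    sum_eq_smul_average g, smul_smul]

theorem IsMixing.sum_norm_sq_deviation_le (hW : IsMixing κ W) :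
    ∑ i, ‖∑ k, W k i • (x k - average x)‖ ^ 2 ≤ (1 - 2 * κ) * dispersion x :=
  hW.sum_norm_sq_le (sum_sub_average x)

theorem IsMixing.sum_norm_sq_drift_le (hκ : 0 ≤ κ) (hW : IsMixing κ W) :
    ∑ i, ‖drift W γ x g i‖ ^ 2 ≤ 8 * dispersion x + 2 * γ ^ 2 * ∑ i, ‖g i‖ ^ 2 := by
  have client_le (i : Fin n) : ‖drift W γ x g i‖ ^ 2
      ≤ 4 * ‖∑ k, W k i • (x k - average x)‖ ^ 2 + 4 * ‖x i - average x‖ ^ 2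
        + 2 * γ ^ 2 * ‖g i‖ ^ 2 := by
    rw [drift_eq_deviations hW.mem_doublyStochastic]
    have split_gradient := norm_sub_sq_le_young one_pos
      (∑ k, W k i • (x k - average x) - (x i - average x)) (γ • g i)
    have split_averaging := norm_sub_sq_le_young one_pos
      (∑ k, W k i • (x k - average x)) (x i - average x)
    rw [norm_smul, mul_pow, Real.norm_eq_abs, sq_abs] at split_gradient
    linarith
  have sum_le := Finset.sum_le_sum fun i (_ : i ∈ Finset.univ) => client_le i
  simp only [Finset.sum_add_distrib, ← Finset.mul_sum] at sum_le
  rw [← dispersion] at sum_le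
  linarith [hW.sum_norm_sq_deviation_le (x := x), mul_nonneg hκ (dispersion_nonneg x)]

theorem IsMixing.sum_norm_sq_deviation_add_drift_le (hκ0 : 0 < κ) (hκ1 : κ ≤ 1)
    (hW : IsMixing κ W) :
    ∑ i, ‖x i - average x + drift W γ x g i‖ ^ 2
      ≤ (1 - κ) * dispersion x + 2 / κ * γ ^ 2 * ∑ i, ‖g i‖ ^ 2 := by
  have young_coeff : 1 + 1 / κ ≤ 2 / κ := by
    rw [le_div_iff₀ hκ0, add_mul, one_div_mul_cancel hκ0.ne']; linarith
  have client_le (i : Fin n) : ‖x i - average x + drift W γ x g i‖ ^ 2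
      ≤ (1 + κ) * ‖∑ k, W k i • (x k - average x)‖ ^ 2 + 2 / κ * γ ^ 2 * ‖g i‖ ^ 2 := by
    rw [drift_eq_deviations hW.mem_doublyStochastic, ← add_sub_assoc, add_sub_cancel]
    refine (norm_sub_sq_le_young hκ0 _ _).trans ?_
    rw [norm_smul, mul_pow, Real.norm_eq_abs, sq_abs, mul_assoc (2 / κ)]
    gcongr
  have sum_le := Finset.sum_le_sum fun i (_ : i ∈ Finset.univ) => client_le i
  simp only [Finset.sum_add_distrib, ← Finset.mul_sum] at sum_le
  have contraction := mul_le_mul_of_nonneg_left (hW.sum_norm_sq_deviation_le (x := x))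
    (by linarith : 0 ≤ 1 + κ)
  linarith [mul_nonneg (sq_nonneg κ) (dispersion_nonneg x)]

theorem sum_inner_drift_le (hW : W ∈ doublyStochastic ℝ (Fin n)) (hγ : 0 ≤ γ)
    (hgh : ∀ i, ‖g i - h i‖ ≤ L * ‖x i - average x‖) :
    ∑ i, inner ℝ (average h) (drift W γ x g i)
      ≤ -(3 / 4) * (γ * n) * ‖average h‖ ^ 2 + γ * L ^ 2 * dispersion x := by
  have average_sub_le : ‖average h - average g‖ ^ 2 ≤ 1 / n * (L ^ 2 * dispersion x) := by
    rw [← average_sub, dispersion, Finset.mul_sum]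
    refine (norm_average_sq_le _).trans ?_
    gcongr with i
    rw [norm_sub_rev, ← mul_pow]
    gcongr
    exact hgh i
  have inner_ge := mul_le_mul_of_nonneg_left
    (three_quarters_mul_norm_sq_sub_le_inner (average h) (average g))
    (by positivity : 0 ≤ γ * n)
  have scaled := mul_le_mul_of_nonneg_left average_sub_le (by positivity : 0 ≤ γ * n)
  have hn0 : (n : ℝ) ≠ 0 := NeZero.ne _
  rw [show γ * n * (1 / n * (L ^ 2 * dispersion x)) = γ * L ^ 2 * dispersion x by field_simp]
    at scaled
  rw [← inner_sum, sum_drift hW, inner_neg_right, real_inner_smul_right]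
  linarith

theorem sum_norm_sq_gradient_le (hgh : ∀ i, ‖g i - h i‖ ≤ L * ‖x i - average x‖)
    {G : Model d} (hζ : 1 / n * ∑ i, ‖G - h i‖ ^ 2 ≤ ζ ^ 2) :
    ∑ i, ‖g i‖ ^ 2 ≤ 3 * L ^ 2 * dispersion x + 3 * n * ζ ^ 2 + 3 * n * ‖G‖ ^ 2 := by
  have client_le (i : Fin n) : ‖g i‖ ^ 2
      ≤ 3 * L ^ 2 * ‖x i - average x‖ ^ 2 + 3 * ‖G - h i‖ ^ 2 + 3 * ‖G‖ ^ 2 := by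
    have split := norm_add_add_sq_le (g i - h i) (h i - G) G
    rw [sub_add_sub_cancel, sub_add_cancel, norm_sub_rev (h i) G] at split
    have lipschitz := pow_le_pow_left₀ (norm_nonneg _) (hgh i) 2
    rw [mul_pow] at lipschitz
    linarith
  have sum_le := Finset.sum_le_sum fun i (_ : i ∈ Finset.univ) => client_le i
  simp only [Finset.sum_add_distrib, ← Finset.mul_sum, Finset.sum_const, Finset.card_univ,
    Fintype.card_fin, nsmul_eq_mul] at sum_le
  rw [one_div, inv_mul_le_iff₀ (by simp [Nat.pos_of_ne_zero (NeZero.ne n)])] at hζ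
  rw [dispersion]
  linarith

end Drift

section SmallStep

variable {n d : ℕ} {γ κ L ζ : ℝ}

/-- The step size `γ` is small with respect to the spectral gap `κ`, the smoothness constant `L` and
the number `n` of clients. -/
structure IsSmallStep (n : ℕ) (L κ γ : ℝ) : Prop where
  nonneg : 0 ≤ γ
  gap_pos : 0 < κ
  gap_le_one : κ ≤ 1
  mul_le_gap : γ * L ≤ 2 * κ ^ 2 / 193
  mul_card_le : γ * L * n ≤ 1 / 2

/-- Weight of the consensus error in the Lyapunov function. The factor `5` makes the contraction
of the consensus error pay for the `4 L / n³` it contributes through the smoothness of the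
objective and for `L / n³` more. -/
noncomputable def consensusWeight (n : ℕ) (L κ : ℝ) : ℝ := 5 * L / (n ^ 2 * κ)

theorem consensusWeight_nonneg (hL : 0 ≤ L) (hκ : 0 ≤ κ) : 0 ≤ consensusWeight n L κ := by
  unfold consensusWeight
  positivity

theorem IsSmallStep.gradient_coeff_le (hn : 2 ≤ n) (hγ : IsSmallStep n L κ γ) :
    33 * (L * γ ^ 2 / κ ^ 2) ≤ γ * n / 4 := by
  have hκ2 : 0 < κ ^ 2 := pow_pos hγ.gap_pos 2
  have hn2 : (2 : ℝ) ≤ n := by exact_mod_cast hn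
  rw [mul_div_assoc', div_le_iff₀ hκ2]
  have hγκ := mul_nonneg hγ.nonneg hκ2.le
  linarith [mul_le_mul_of_nonneg_left hγ.mul_le_gap hγ.nonneg,
    mul_le_mul_of_nonneg_left hn2 hγκ]

theorem IsSmallStep.dispersion_coeff_le [NeZero n] (hL : 0 ≤ L) (hγ : IsSmallStep n L κ γ) :
    γ * L ^ 2 + 33 * (L * γ ^ 2 / κ ^ 2) * L ^ 2 / n ≤ L / n := by
  have hκ2 : 0 < κ ^ 2 := pow_pos hγ.gap_pos 2
  have hn0 : (n : ℝ) ≠ 0 := NeZero.ne _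
  have second_le : 33 * (γ * L) ^ 2 / κ ^ 2 ≤ 1 / 2 := by
    have hγL : 0 ≤ γ * L := mul_nonneg hγ.nonneg hL
    have hκ2_le : κ ^ 2 ≤ 1 := pow_le_one₀ hγ.gap_pos.le hγ.gap_le_one
    rw [div_le_iff₀ hκ2, sq]
    have hγL_le : γ * L ≤ 2 / 193 := hγ.mul_le_gap.trans (by linarith)
    linarith [mul_le_mul_of_nonneg_left hγ.mul_le_gap hγL,
      mul_le_mul_of_nonneg_right hγL_le hκ2.le]
  calc γ * L ^ 2 + 33 * (L * γ ^ 2 / κ ^ 2) * L ^ 2 / n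
      = (γ * L * n + 33 * (γ * L) ^ 2 / κ ^ 2) * (L / n) := by field_simp
    _ ≤ 1 * (L / n) := by gcongr; linarith [hγ.mul_card_le]
    _ = L / n := one_mul _

/-- The bounds on the mean displacements in the form used for the Lyapunov function, scaled by
`n ^ 2`. Here `V` is the consensus error, `D` the squared norm of the global gradient, and `S` the
sum of the squared norms of the local ones. -/
theorem IsSmallStep.collect_coefficients (hn : 2 ≤ n) (hL : 0 ≤ L) (hγ : IsSmallStep n L κ γ)
    {V D S P Q R : ℝ} (hV : 0 ≤ V) (hD : 0 ≤ D) (hS0 : 0 ≤ S)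
    (hS : S ≤ 3 * L ^ 2 * V + 3 * n * ζ ^ 2 + 3 * n * D)
    (hP : P ≤ -(3 / 4) * (γ * n) * D + γ * L ^ 2 * V)
    (hQ : Q ≤ 8 * V + 2 * γ ^ 2 * S) (hR : R ≤ (1 - κ) * V + 2 / κ * γ ^ 2 * S) :
    P + L / (2 * n) * Q + 5 * L / (n * κ) * (R - V)
      ≤ -(γ * n / 2) * D + 33 * (L * γ ^ 2 / κ ^ 2) * ζ ^ 2 := by
  have : NeZero n := ⟨by omega⟩
  have hκ0 := hγ.gap_pos
  have hQ' : L / (2 * n) * Q ≤ 4 * (L / n) * V + L * γ ^ 2 / n * S := by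
    refine (mul_le_mul_of_nonneg_left hQ (by positivity)).trans_eq ?_
    field_simp; ring
  have hR' : 5 * L / (n * κ) * (R - V)
      ≤ -(5 * (L / n)) * V + L * γ ^ 2 / n * (10 / κ ^ 2) * S := by
    refine (mul_le_mul_of_nonneg_left (sub_le_sub_right hR V) (by positivity)).trans_eq ?_
    field_simp; ring
  have young_coeff : 1 + 10 / κ ^ 2 ≤ 11 / κ ^ 2 := by
    rw [le_div_iff₀ (by positivity), add_mul, div_mul_cancel₀ _ (by positivity)]
    nlinarith [hγ.gap_le_one]
  have hS' : L * γ ^ 2 / n * (1 + 10 / κ ^ 2) * S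
      ≤ 33 * (L * γ ^ 2 / κ ^ 2) * L ^ 2 / n * V + 33 * (L * γ ^ 2 / κ ^ 2) * ζ ^ 2
        + 33 * (L * γ ^ 2 / κ ^ 2) * D :=
    calc L * γ ^ 2 / n * (1 + 10 / κ ^ 2) * S
        ≤ L * γ ^ 2 / n * (11 / κ ^ 2) * (3 * L ^ 2 * V + 3 * n * ζ ^ 2 + 3 * n * D) := by gcongr
      _ = _ := by field_simp; ring
  have hcV := mul_le_mul_of_nonneg_right (hγ.dispersion_coeff_le hL) hV
  have hcD := mul_le_mul_of_nonneg_right (hγ.gradient_coeff_le hn) hD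
  linarith

theorem average_change_le {W : Matrix (Fin n) (Fin n) ℝ} {x g h : Fin n → Model d} (hn : 2 ≤ n)
    (hL : 0 ≤ L) (hγ : IsSmallStep n L κ γ) (hW : IsMixing κ W)
    (hgh : ∀ i, ‖g i - h i‖ ≤ L * ‖x i - average x‖)
    (hζ : 1 / n * ∑ i, ‖average h - h i‖ ^ 2 ≤ ζ ^ 2) :
    1 / n * ∑ i, (inner ℝ ((1 / (n : ℝ)) • average h
          + (2 * consensusWeight n L κ) • (x i - average x)) (drift W γ x g i)
        + (L / (2 * n ^ 2) + consensusWeight n L κ) * ‖drift W γ x g i‖ ^ 2)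
      ≤ -(γ / (2 * n)) * ‖average h‖ ^ 2 + 33 * (L * γ ^ 2 / (n ^ 2 * κ ^ 2)) * ζ ^ 2 := by
  have : NeZero n := ⟨by omega⟩
  have hn0 : (n : ℝ) ≠ 0 := NeZero.ne _
  have hκ0 := hγ.gap_pos.ne'
  have bound := hγ.collect_coefficients hn hL (dispersion_nonneg x) (sq_nonneg ‖average h‖)
    (Finset.sum_nonneg fun i _ => sq_nonneg ‖g i‖) (sum_norm_sq_gradient_le hgh hζ)
    (sum_inner_drift_le hW.mem_doublyStochastic hγ.nonneg hgh)
    (hW.sum_norm_sq_drift_le hγ.gap_pos.le)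
    (hW.sum_norm_sq_deviation_add_drift_le hγ.gap_pos hγ.gap_le_one)
  have deviation_change : ∑ i, ‖x i - average x + drift W γ x g i‖ ^ 2 - dispersion x
      = ∑ i, (2 * inner ℝ (x i - average x) (drift W γ x g i) + ‖drift W γ x g i‖ ^ 2) := by
    rw [dispersion, ← Finset.sum_sub_distrib]
    exact Finset.sum_congr rfl fun i _ => by rw [norm_add_sq_real]; ring
  rw [deviation_change, Finset.mul_sum, Finset.mul_sum, ← Finset.sum_add_distrib,
    ← Finset.sum_add_distrib] at bound
  calc _ = 1 / (n : ℝ) ^ 2 * _ := ?_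
    _ ≤ 1 / (n : ℝ) ^ 2 * _ := mul_le_mul_of_nonneg_left bound (by positivity)
    _ = _ := by field_simp
  rw [Finset.mul_sum, Finset.mul_sum]
  refine Finset.sum_congr rfl fun i _ => ?_
  rw [inner_add_left, real_inner_smul_left, real_inner_smul_left, consensusWeight]
  field_simp
  ring

end SmallStep

section Variance

variable {Ω E ι : Type*} [MeasurableSpace Ω] {μ : Measure Ω}
  [NormedAddCommGroup E] [InnerProductSpace ℝ E]

theorem integral_norm_sq_eq [CompleteSpace E] [IsProbabilityMeasure μ] {X : Ω → E}
    (hX : MemLp X 2 μ) : ∫ ω, ‖X ω‖ ^ 2 ∂μ = ‖μ[X]‖ ^ 2 + ∫ ω, ‖X ω - μ[X]‖ ^ 2 ∂μ := by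
  have integrable_X := hX.integrable one_le_two
  have integrable_cross : Integrable (fun ω => 2 * inner ℝ (X ω) μ[X]) μ :=
    (integrable_X.inner_const _).const_mul 2
  have integrable_diff : Integrable (fun ω => ‖X ω‖ ^ 2 - 2 * inner ℝ (X ω) μ[X]) μ :=
    hX.norm.integrable_sq.sub integrable_cross
  simp only [norm_sub_sq_real]
  rw [integral_add integrable_diff (integrable_const _),
    integral_sub hX.norm.integrable_sq integrable_cross, integral_const_mul]
  have integral_inner_mean : ∫ ω, inner ℝ (X ω) μ[X] ∂μ = ‖μ[X]‖ ^ 2 := by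
    simp only [real_inner_comm μ[X]]
    rw [integral_inner integrable_X, real_inner_self_eq_norm_sq]
  rw [integral_inner_mean]
  simp only [integral_const, probReal_univ, one_smul]
  ring

theorem integral_quadratic [CompleteSpace E] [IsProbabilityMeasure μ] {X : Ω → E}
    (hX : MemLp X 2 μ) (c : ℝ) (b : E) (C : ℝ) :
    ∫ ω, (c + inner ℝ b (X ω) + C * ‖X ω‖ ^ 2) ∂μ
      = c + inner ℝ b μ[X] + C * (‖μ[X]‖ ^ 2 + ∫ ω, ‖X ω - μ[X]‖ ^ 2 ∂μ) := by
  have integrable_inner := (hX.integrable one_le_two).const_inner (𝕜 := ℝ) b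
  have integrable_affine : Integrable (fun ω => c + inner ℝ b (X ω)) μ :=
    (integrable_const c).add integrable_inner
  rw [integral_add integrable_affine
      (hX.norm.integrable_sq.const_mul C), integral_add (integrable_const c) integrable_inner,
    integral_inner (hX.integrable one_le_two), integral_const_mul, integral_norm_sq_eq hX]
  simp

theorem integral_norm_sq_sum_of_pairwise_indepFun [Fintype ι] [CompleteSpace E] [IsFiniteMeasure μ]
    [MeasurableSpace E] [BorelSpace E] {X : ι → Ω → E} (hX : ∀ i, MemLp (X i) 2 μ)
    (hX_mean : ∀ i, μ[X i] = 0) (hind : Pairwise fun i j => X i ⟂ᵢ[μ] X j) :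
    ∫ ω, ‖∑ i, X i ω‖ ^ 2 ∂μ = ∑ i, ∫ ω, ‖X i ω‖ ^ 2 ∂μ := by
  classical
  have integrable_inner (i j : ι) : Integrable (fun ω => inner ℝ (X i ω) (X j ω)) μ :=
    memLp_one_iff_integrable.1 ((innerSL ℝ).memLp_of_bilin 1 (hX i) (hX j))
  have integral_inner (i j : ι) :
      ∫ ω, inner ℝ (X i ω) (X j ω) ∂μ = if i = j then ∫ ω, ‖X i ω‖ ^ 2 ∂μ else 0 := by
    split_ifs with hij
    · simp only [← hij, real_inner_self_eq_norm_sq]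
    · exact ((hind hij).integral_bilin ((hX i).integrable one_le_two)
        ((hX j).integrable one_le_two) (innerSL ℝ)).trans (by simp [hX_mean])
  have expand (ω : Ω) : ‖∑ i, X i ω‖ ^ 2 = ∑ i, ∑ j, inner ℝ (X i ω) (X j ω) := by
    rw [← real_inner_self_eq_norm_sq, sum_inner]
    simp only [inner_sum]
  simp only [expand]
  rw [integral_finsetSum _ fun i _ => integrable_finsetSum _ fun j _ => integrable_inner i j]
  refine Finset.sum_congr rfl fun i _ => ?_
  rw [integral_finsetSum _ fun j _ => integrable_inner i j]
  simp [integral_inner]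

end Variance

section SampleMean

variable {Ξ E : Type*} {M : ℕ} [MeasurableSpace Ξ] {ν : Measure Ξ} [IsProbabilityMeasure ν]
  [NormedAddCommGroup E] [InnerProductSpace ℝ E] {g : Ξ → E}

theorem memLp_sampleMean (hg : MemLp g 2 ν) :
    MemLp (fun ξ : Fin M → Ξ => (1 / (M : ℝ)) • ∑ m, g (ξ m)) 2 (Measure.pi fun _ => ν) :=
  (memLp_finsetSum Finset.univ fun m _ =>
    hg.comp_measurePreserving (measurePreserving_eval (fun _ => ν) m)).const_smul _

variable [NeZero M]

theorem integral_sampleMean (hg : Integrable g ν) :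
    ∫ ξ : Fin M → Ξ, (1 / (M : ℝ)) • ∑ m, g (ξ m) ∂(Measure.pi fun _ => ν) = ν[g] := by
  have hM0 : (M : ℝ) ≠ 0 := NeZero.ne _
  have integrable_coord (m : Fin M) :
      Integrable (fun ξ : Fin M → Ξ => g (ξ m)) (Measure.pi fun _ => ν) :=
    (measurePreserving_eval (fun _ => ν) m).integrable_comp_of_integrable hg
  have integral_coord (m : Fin M) : ∫ ξ : Fin M → Ξ, g (ξ m) ∂(Measure.pi fun _ => ν) = ν[g] :=
    integral_comp_eval hg.1
  rw [integral_smul, integral_finsetSum _ fun m _ => integrable_coord m]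
  simp only [integral_coord, Finset.sum_const, Finset.card_univ, Fintype.card_fin,
    ← Nat.cast_smul_eq_nsmul ℝ, smul_smul]
  rw [one_div_mul_cancel hM0, one_smul]

theorem integral_norm_sq_sampleMean_sub [CompleteSpace E] (hg : MemLp g 2 ν) :
    ∫ ξ : Fin M → Ξ, ‖(1 / (M : ℝ)) • ∑ m, g (ξ m) - ν[g]‖ ^ 2 ∂(Measure.pi fun _ => ν)
      = (∫ ξ, ‖g ξ - ν[g]‖ ^ 2 ∂ν) / M := by
  borelize E
  have hM0 : (M : ℝ) ≠ 0 := NeZero.ne _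
  have hY : MemLp (fun ξ => g ξ - ν[g]) 2 ν := hg.sub (memLp_const _)
  have hY_mean : ∫ ξ, (g ξ - ν[g]) ∂ν = 0 := by
    rw [integral_sub (hg.integrable one_le_two) (integrable_const _)]
    simp
  have average_centred (ξ : Fin M → Ξ) : (1 / (M : ℝ)) • ∑ m, g (ξ m) - ν[g]
      = (1 / (M : ℝ)) • ∑ m, (g (ξ m) - ν[g]) := by
    rw [Finset.sum_sub_distrib, smul_sub, Finset.sum_const, Finset.card_univ, Fintype.card_fin,
      ← Nat.cast_smul_eq_nsmul ℝ, smul_smul, one_div_mul_cancel hM0, one_smul]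
  have independent := iIndepFun_pi (μ := fun _ : Fin M => ν) fun _ => hY.1.aemeasurable
  have variance_sum := integral_norm_sq_sum_of_pairwise_indepFun
    (fun m => hY.comp_measurePreserving (measurePreserving_eval (fun _ : Fin M => ν) m))
    (fun m => (integral_comp_eval (μ := fun _ : Fin M => ν) (i := m) hY.1).trans hY_mean)
    fun m m' hmm' => independent.indepFun hmm'
  have variance_coord (m : Fin M) :
      ∫ ξ : Fin M → Ξ, ‖g (ξ m) - ν[g]‖ ^ 2 ∂(Measure.pi fun _ => ν)
        = ∫ ξ, ‖g ξ - ν[g]‖ ^ 2 ∂ν :=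
    integral_comp_eval (μ := fun _ : Fin M => ν) (hY.1.norm.pow 2)
  simp only [average_centred, norm_smul, mul_pow, integral_const_mul]
  rw [show ∫ ξ : Fin M → Ξ, ‖∑ m, (g (ξ m) - ν[g])‖ ^ 2 ∂(Measure.pi fun _ => ν) = _ from
    variance_sum]
  simp [variance_coord]
  field_simp

end SampleMean

section Sampling

variable {n d M : ℕ} {Ξ : Type*} [MeasurableSpace Ξ]

/-- A partial derivative is a limit of difference quotients, which are jointly measurable. -/
theorem measurable_lossGradient {ℓ : Model d → Ξ → ℝ} (hm : Measurable (Function.uncurry ℓ))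
    (hd : ∀ ξ, Differentiable ℝ (fun x => ℓ x ξ)) :
    Measurable (Function.uncurry (lossGradient ℓ)) := by
  suffices coordinate : ∀ c, Measurable fun q => Function.uncurry (lossGradient ℓ) q c from
    (WithLp.measurable_toLp 2 _).comp (measurable_pi_lambda _ coordinate)
  intro c
  set v : Model d := EuclideanSpace.single c 1 with hv
  refine measurable_of_tendsto_metrizable
    (f := fun (k : ℕ) (q : Model d × Ξ) =>
      (k : ℝ) * (ℓ (q.1 + (k : ℝ)⁻¹ • v) q.2 - ℓ q.1 q.2)) (fun k => ?_) ?_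
  · have shifted : Measurable (fun q : Model d × Ξ => ℓ (q.1 + (k : ℝ)⁻¹ • v) q.2) :=
      hm.comp ((measurable_fst.add_const _).prodMk measurable_snd)
    exact (shifted.sub hm).const_mul _
  · rw [tendsto_pi_nhds]
    intro q
    have quotient_lim := (hd q.2 q.1).hasGradientAt.hasFDerivAt.lim v (c := fun k : ℕ => (k : ℝ))
      (l := atTop) (by simpa using tendsto_natCast_atTop_atTop)
    rw [InnerProductSpace.toDual_apply_apply, hv, EuclideanSpace.inner_single_right]
      at quotient_lim
    simpa [Function.uncurry, lossGradient] using quotient_lim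

theorem lintegral_stepLaw (p : Fin n → ℝ) (D : Fin n → Measure Ξ) [∀ i, IsProbabilityMeasure (D i)]
    {F : Fin n × (Fin M → Ξ) → ENNReal} (hF : Measurable F) :
    ∫⁻ z, F z ∂(stepLaw M p D)
      = ∑ i, ENNReal.ofReal (p i) * ∫⁻ ξ, F (i, ξ) ∂(Measure.pi fun _ : Fin M => D i) := by
  rw [stepLaw, lintegral_finsetSum_measure]
  refine Finset.sum_congr rfl fun i _ => ?_
  rw [lintegral_smul_measure, Measure.dirac_prod, lintegral_map hF measurable_prodMk_left,
    smul_eq_mul]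

end Sampling

section Chain

variable {S Z Ω : Type*}

/-- State at time `t` of the system started at `s0` whose state `s` at time `k` becomes
`step k s (z k)`. For independent random inputs `z` it is a Markov chain. -/
def iterates (step : ℕ → S → Z → S) (s0 : S) (z : ℕ → Z) : ℕ → S
  | 0 => s0
  | t + 1 => step t (iterates step s0 z t) (z t)

variable [MeasurableSpace S] [MeasurableSpace Z] {step : ℕ → S → Z → S} {s0 : S} {ξ : ℕ → Ω → Z}

theorem measurable_iterates_iSup (hstep : ∀ t, Measurable (Function.uncurry (step t))) (t : ℕ) :
    Measurable[⨆ k ∈ Set.Iio t, MeasurableSpace.comap (ξ k) inferInstance]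
      (fun ω => iterates step s0 (fun k => ξ k ω) t) := by
  induction t with
  | zero => exact measurable_const
  | succ t ih =>
    have measurable_past : Measurable[⨆ k ∈ Set.Iio (t + 1),
        MeasurableSpace.comap (ξ k) inferInstance] (fun ω => iterates step s0 (fun k => ξ k ω) t) :=
      ih.mono (biSup_mono fun k hk => lt_trans hk (Nat.lt_succ_self t)) le_rfl
    have measurable_input : Measurable[⨆ k ∈ Set.Iio (t + 1),
        MeasurableSpace.comap (ξ k) inferInstance] (ξ t) :=
      (comap_measurable (ξ t)).mono
        (le_biSup (fun k => MeasurableSpace.comap (ξ k) inferInstance) (Nat.lt_succ_self t)) le_rfl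
    exact (hstep t).comp (measurable_past.prodMk measurable_input)

variable [MeasurableSpace Ω] {μ : Measure Ω}

theorem measurable_iterates (hstep : ∀ t, Measurable (Function.uncurry (step t)))
    (hξ : ∀ t, Measurable (ξ t)) (t : ℕ) :
    Measurable (fun ω => iterates step s0 (fun k => ξ k ω) t) :=
  (measurable_iterates_iSup hstep t).mono (iSup₂_le fun k _ => (hξ k).comap_le) le_rfl

theorem indepFun_iterates (hstep : ∀ t, Measurable (Function.uncurry (step t)))
    (hξ : ∀ t, Measurable (ξ t)) (hind : iIndepFun ξ μ) (t : ℕ) :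
    (fun ω => iterates step s0 (fun k => ξ k ω) t) ⟂ᵢ[μ] ξ t := by
  have past_present := indep_iSup_of_disjoint (fun k => (hξ k).comap_le) hind.iIndep
    (S := Set.Iio t) (T := {t}) (by simp)
  refine indep_of_indep_of_le_left (indep_of_indep_of_le_right past_present ?_) ?_
  · exact le_biSup (fun k => MeasurableSpace.comap (ξ k) inferInstance) (Set.mem_singleton t)
  · exact (measurable_iterates_iSup hstep t).comap_le

variable [IsProbabilityMeasure μ] {law : Measure Z} {ψ φ : S → ENNReal} {K : ENNReal}

theorem lintegral_iterates_succ (hstep : ∀ t, Measurable (Function.uncurry (step t)))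
    (hξ : ∀ t, Measurable (ξ t)) (hind : iIndepFun ξ μ) {t : ℕ} (hlaw : μ.map (ξ t) = law)
    (hψ : Measurable ψ) :
    ∫⁻ ω, ψ (iterates step s0 (fun k => ξ k ω) (t + 1)) ∂μ
      = ∫⁻ ω, ∫⁻ z, ψ (step t (iterates step s0 (fun k => ξ k ω) t) z) ∂law ∂μ := by
  have hX := measurable_iterates (s0 := s0) hstep hξ t
  have hm : Measurable (fun q : S × Z => ψ (step t q.1 q.2)) := hψ.comp (hstep t)
  have : IsProbabilityMeasure law :=
    hlaw ▸ Measure.isProbabilityMeasure_map (hξ t).aemeasurable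
  have := Measure.isProbabilityMeasure_map (μ := μ) hX.aemeasurable
  have joint_law := (indepFun_iterates (s0 := s0) hstep hξ hind t).map_prod_eq_prod_map_map
    hX.aemeasurable (hξ t).aemeasurable
  rw [← lintegral_map (f := fun s => ∫⁻ z, ψ (step t s z) ∂law) hm.lintegral_prod_right' hX,
    ← lintegral_prod (fun q : S × Z => ψ (step t q.1 q.2)) hm.aemeasurable, ← hlaw, ← joint_law,
    lintegral_map hm (hX.prodMk (hξ t))]
  rfl

theorem lintegral_iterates_add_sum_le (hstep : ∀ t, Measurable (Function.uncurry (step t)))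
    (hξ : ∀ t, Measurable (ξ t)) (hind : iIndepFun ξ μ) (hψ : Measurable ψ) (hφ : Measurable φ)
    {T : ℕ} (hlaw : ∀ t < T, μ.map (ξ t) = law)
    (hdrift : ∀ t < T, ∀ s, ∫⁻ z, ψ (step t s z) ∂law + φ s ≤ ψ s + K) :
    ∫⁻ ω, ψ (iterates step s0 (fun k => ξ k ω) T) ∂μ
        + ∑ t ∈ Finset.range T, ∫⁻ ω, φ (iterates step s0 (fun k => ξ k ω) t) ∂μ
      ≤ ψ s0 + T * K := by
  induction T with
  | zero => simp [iterates]
  | succ T ih =>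
    set X : ℕ → Ω → S := fun t ω => iterates step s0 (fun k => ξ k ω) t
    have one_step : ∫⁻ ω, ψ (X (T + 1) ω) ∂μ + ∫⁻ ω, φ (X T ω) ∂μ ≤ ∫⁻ ω, ψ (X T ω) ∂μ + K := by
      have hφX : Measurable (fun ω => φ (X T ω)) := hφ.comp (measurable_iterates hstep hξ T)
      rw [lintegral_iterates_succ hstep hξ hind (hlaw T T.lt_succ_self) hψ,
        ← lintegral_add_right _ hφX]
      calc _ ≤ ∫⁻ ω, (ψ (X T ω) + K) ∂μ :=
            lintegral_mono fun ω => hdrift T T.lt_succ_self (X T ω)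
        _ = _ := by simp [lintegral_add_right _ measurable_const]
    rw [Finset.sum_range_succ]
    calc _ = ∑ t ∈ Finset.range T, ∫⁻ ω, φ (X t ω) ∂μ
          + (∫⁻ ω, ψ (X (T + 1) ω) ∂μ + ∫⁻ ω, φ (X T ω) ∂μ) := by ring
      _ ≤ ∑ t ∈ Finset.range T, ∫⁻ ω, φ (X t ω) ∂μ + (∫⁻ ω, ψ (X T ω) ∂μ + K) := by gcongr
      _ = (∫⁻ ω, ψ (X T ω) ∂μ + ∑ t ∈ Finset.range T, ∫⁻ ω, φ (X t ω) ∂μ) + K := by ring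
      _ ≤ (ψ s0 + T * K) + K := add_le_add_left
        (ih (fun t ht => hlaw t (by omega)) fun t ht => hdrift t (by omega)) K
      _ = _ := by push_cast; ring

end Chain

section Reduction

variable {n d M s T t : ℕ} {Ξ : Type*}

/-- One iteration of SWIFT in which the active client `z.1` averages with the coefficients `W`, its
mini-batch being `z.2`. It is the iteration at every time of a run with communication set `C_0`. -/
noncomputable def averagedStep (ℓ : Model d → Ξ → ℝ) (W : Matrix (Fin n) (Fin n) ℝ) (γ : ℝ)
    (x : Fin n → Model d) (z : Fin n × (Fin M → Ξ)) : Fin n → Model d :=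
  Function.update x z.1 (∑ k, W k z.1 • x k - γ • batchGradient ℓ (x z.1) z.2)

/-- Displacement of client `i` in an iteration in which it is active and draws the mini-batch `ξ`.
Its mean is the `drift` along the local gradients. -/
noncomputable def displacement (ℓ : Model d → Ξ → ℝ) (W : Matrix (Fin n) (Fin n) ℝ) (γ : ℝ)
    (x : Fin n → Model d) (i : Fin n) (ξ : Fin M → Ξ) : Model d :=
  ∑ k, W k i • x k - x i - γ • batchGradient ℓ (x i) ξ

theorem averagedStep_eq_update_displacement (ℓ : Model d → Ξ → ℝ)
    (W : Matrix (Fin n) (Fin n) ℝ) (γ : ℝ) (x : Fin n → Model d) (i : Fin n) (ξ : Fin M → Ξ) :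
    averagedStep ℓ W γ x (i, ξ) = Function.update x i (x i + displacement ℓ W γ x i ξ) := by
  rw [averagedStep, displacement, sub_right_comm, add_sub_cancel]

theorem counter_le_succ (a : ℕ → Fin n) (t : ℕ) (i : Fin n) : counter a t i ≤ t + 1 := by
  induction t generalizing i with
  | zero => simp [counter]
  | succ t ih =>
    rw [counter]
    rcases eq_or_ne i (a t) with rfl | hi
    · rw [Function.update_self]
      exact Nat.succ_le_succ (ih (a t))
    · rw [Function.update_of_ne hi]
      exact (ih i).trans (Nat.le_succ _)

theorem counter_mem_commSet_zero (ht : t < T) (a : ℕ → Fin n) (i : Fin n) :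
    counter a t i ∈ commSet 0 T :=
  ⟨Nat.mod_one _, (counter_le_succ a t i).trans ht⟩

theorem activeCoeff_zero (w : ℕ → Fin n → Fin n → ℝ) (ht : t < T) (a : ℕ → Fin n) :
    activeCoeff w 0 T a t = w t := by
  funext j i
  rw [activeCoeff, if_pos (counter_mem_commSet_zero ht a i)]

theorem eq_zero_of_gramEigenvalue_lt_one {p : Fin n → ℝ} (hp : ∀ i, p i = 1 / (n : ℝ))
    {w : ℕ → Fin n → Fin n → ℝ} {a : ℕ → Fin n} {k : Fin n}
    (h : gramEigenvalue (expectedCommMatrix p (activeCoeff w s T a 0)) k < 1) : s = 0 := by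
  have : NeZero n := ⟨by rintro rfl; exact k.elim0⟩
  by_contra hs
  have one_notMem : 1 ∉ commSet s T := fun h1 => by
    have one_mod : 1 % (s + 1) = 0 := h1.1
    rw [Nat.mod_eq_of_lt (by omega)] at one_mod
    exact one_ne_zero one_mod
  have no_averaging : Matrix.of (activeCoeff w s T a 0) = 1 := by
    ext j i
    simp [activeCoeff, counter, one_notMem, Matrix.one_apply]
  rw [expectedCommMatrix_uniform hp, no_averaging, ← add_smul, sub_add_cancel, one_smul,
    gramEigenvalue_one] at h
  exact lt_irrefl _ h

theorem models_eq_iterates (ℓ : Model d → Ξ → ℝ) (w : ℕ → Fin n → Fin n → ℝ) (γ : ℝ)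
    (x0 : Model d) (a : ℕ → Fin n) (b : ℕ → Fin M → Ξ) (ht : t ≤ T) :
    models ℓ w 0 T γ x0 a b t = iterates (fun t => averagedStep ℓ (Matrix.of (w t)) γ)
      (fun _ => x0) (fun k => (a k, b k)) t := by
  induction t with
  | zero => rfl
  | succ t ih =>
    rw [models, iterates, ← ih (by omega)]
    simp only [if_pos (counter_mem_commSet_zero ht a (a t)), averagedStep, Matrix.of_apply]

theorem models_of_stepSize_zero (ℓ : Model d → Ξ → ℝ) {w : ℕ → Fin n → Fin n → ℝ}
    (hw : ∀ t i, ∑ j, w t j i = 1) (s T : ℕ) (x0 : Model d) (a : ℕ → Fin n)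
    (b : ℕ → Fin M → Ξ) (t : ℕ) : models ℓ w s T 0 x0 a b t = fun _ => x0 := by
  induction t with
  | zero => rfl
  | succ t ih =>
    rw [models]
    simp only [ih, ← Finset.sum_smul, hw, one_smul, ite_self, zero_smul, sub_zero]
    exact Function.update_eq_self (a t) _

theorem IsCommWeights.mono {G G' : SimpleGraph (Fin n)} {w : Fin n → Fin n → ℝ}
    (hw : IsCommWeights G w) (hG : G ≤ G') : IsCommWeights G' w :=
  { hw with support := fun j i hji => (hw.support j i hji).imp_right (@hG j i) }

theorem IsCommWeights.mem_doublyStochastic {G : SimpleGraph (Fin n)} {w : Fin n → Fin n → ℝ}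
    (hw : IsCommWeights G w) (hbal : ∀ j, ∑ i, w j i = 1) :
    Matrix.of w ∈ doublyStochastic ℝ (Fin n) :=
  mem_doublyStochastic_iff_sum.2 ⟨hw.nonneg, hbal, hw.sum_eq_one⟩

theorem sum_activeCoeff {G : ℕ → SimpleGraph (Fin n)} {w : ℕ → Fin n → Fin n → ℝ}
    (hw : ∀ t, IsCommWeights (G t) (w t)) (a : ℕ → Fin n) (i : Fin n) :
    ∑ j, activeCoeff w s T a t j i = 1 := by
  by_cases hi : counter a t i ∈ commSet s T
  · simp only [activeCoeff, if_pos hi, (hw t).sum_eq_one]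
  · simp [activeCoeff, hi]

end Reduction

section Measurability

variable {n d M : ℕ} {Ξ : Type*} [MeasurableSpace Ξ]

theorem measurable_average : Measurable (average : (Fin n → Model d) → Model d) := by
  unfold average
  fun_prop

theorem measurable_dispersion : Measurable (dispersion : (Fin n → Model d) → ℝ) :=
  Finset.measurable_fun_sum _ fun j _ =>
    ((measurable_pi_apply j).sub measurable_average).norm.pow_const 2

theorem measurable_potential {f : Model d → ℝ} (hf : Measurable f) (fmin β : ℝ) :
    Measurable (potential (n := n) f fmin β) :=
  ((hf.comp measurable_average).sub_const _).add (measurable_dispersion.const_mul _)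

theorem IsLoss.measurable_averagedStep {ℓ : Model d → Ξ → ℝ} {D : Fin n → Measure Ξ}
    (hℓ : IsLoss ℓ D) (W : Matrix (Fin n) (Fin n) ℝ) (γ : ℝ) :
    Measurable (Function.uncurry (averagedStep (M := M) ℓ W γ)) := by
  have lossGradient_measurable := measurable_lossGradient hℓ.measurable hℓ.differentiable
  have measurable_of_active (i : Fin n) :
      Measurable (fun q : (Fin n → Model d) × (Fin M → Ξ) => averagedStep ℓ W γ q.1 (i, q.2)) := by
    have sample (m : Fin M) : Measurable (fun q : (Fin n → Model d) × (Fin M → Ξ) =>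
        lossGradient ℓ (q.1 i) (q.2 m)) :=
      lossGradient_measurable.comp
        (f := fun q : (Fin n → Model d) × (Fin M → Ξ) => (q.1 i, q.2 m)) (by fun_prop)
    have new_model : Measurable (fun q : (Fin n → Model d) × (Fin M → Ξ) =>
        ∑ k, W k i • q.1 k - γ • batchGradient ℓ (q.1 i) q.2) := by
      unfold batchGradient
      fun_prop
    exact measurable_update'.comp (measurable_fst.prodMk new_model)
  have active_last : Measurable (fun q : ((Fin n → Model d) × (Fin M → Ξ)) × Fin n =>
      averagedStep ℓ W γ q.1.1 (q.2, q.1.2)) :=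
    measurable_from_prod_countable_left measurable_of_active
  exact active_last.comp (f := fun q : (Fin n → Model d) × (Fin n × (Fin M → Ξ)) =>
    ((q.1, q.2.2), q.2.1)) (by fun_prop)

end Measurability

section Objective

variable {n d : ℕ} {Ξ : Type*} [MeasurableSpace Ξ] {p : Fin n → ℝ} {ℓ : Model d → Ξ → ℝ}
  {D : Fin n → Measure Ξ} {L : ℝ}

theorem hasGradientAt_globalObjective
    (hd : ∀ i, Differentiable ℝ (localObjective ℓ D i)) (x : Model d) :
    HasGradientAt (globalObjective p ℓ D) (∑ i, p i • ∇ (localObjective ℓ D i) x) x := by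
  rw [hasGradientAt_iff_hasFDerivAt, map_sum]
  simp only [map_smul]
  exact HasFDerivAt.fun_sum fun i _ => ((hd i x).hasGradientAt.hasFDerivAt).const_mul (p i)

theorem isSmooth_globalObjective (hp0 : ∀ i, 0 ≤ p i) (hp1 : ∑ i, p i = 1)
    (hs : ∀ i, IsSmooth L (localObjective ℓ D i)) : IsSmooth L (globalObjective p ℓ D) := by
  have hasGradientAt := hasGradientAt_globalObjective (p := p) fun i => (hs i).1
  refine ⟨fun x => (hasGradientAt x).differentiableAt, fun x y => ?_⟩
  rw [(hasGradientAt x).gradient, (hasGradientAt y).gradient, ← Finset.sum_sub_distrib]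
  calc ‖∑ i, (p i • ∇ (localObjective ℓ D i) x - p i • ∇ (localObjective ℓ D i) y)‖
      ≤ ∑ i, p i * (L * ‖x - y‖) := norm_sum_le_of_le _ fun i _ => by
        rw [← smul_sub, norm_smul, Real.norm_of_nonneg (hp0 i)]
        exact mul_le_mul_of_nonneg_left ((hs i).2 x y) (hp0 i)
    _ = L * ‖x - y‖ := by rw [← Finset.sum_mul, hp1, one_mul]

theorem gradient_globalObjective_uniform (hp : ∀ i, p i = 1 / (n : ℝ))
    (hd : ∀ i, Differentiable ℝ (localObjective ℓ D i)) (x : Model d) :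
    ∇ (globalObjective p ℓ D) x = average fun i => ∇ (localObjective ℓ D i) x := by
  rw [(hasGradientAt_globalObjective hd x).gradient, average, Finset.smul_sum]
  simp only [hp]

theorem IsSmooth.continuous_gradient {f : Model d → ℝ} (hf : IsSmooth L f) : Continuous (∇ f) :=
  (LipschitzWith.of_dist_le' fun x y => by
    rw [dist_eq_norm, dist_eq_norm]; exact hf.2 x y).continuous

theorem gradient_eq_zero_of_forall_le {E : Type*} [NormedAddCommGroup E] [InnerProductSpace ℝ E]
    [CompleteSpace E] {f : E → ℝ} {x : E} (h : ∀ y, f x ≤ f y) : ∇ f x = 0 := by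
  have isLocalMin : IsLocalMin f x := Eventually.of_forall h
  rw [gradient, isLocalMin.fderiv_eq_zero, map_zero]

end Objective

section ExpectedDecrease

theorem lintegral_ofReal_le_of_le_quadratic {Ω E : Type*} [MeasurableSpace Ω] {μ : Measure Ω}
    [IsProbabilityMeasure μ] [NormedAddCommGroup E] [InnerProductSpace ℝ E] [CompleteSpace E]
    {X : Ω → E} (hX : MemLp X 2 μ) {u : Ω → ℝ} (hu : ∀ ω, 0 ≤ u ω) {c C v : ℝ} {b : E} (hC : 0 ≤ C)
    (hle : ∀ ω, u ω ≤ c + inner ℝ b (X ω) + C * ‖X ω‖ ^ 2)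
    (hv : ∫ ω, ‖X ω - μ[X]‖ ^ 2 ∂μ ≤ v) :
    0 ≤ c + inner ℝ b μ[X] + C * (‖μ[X]‖ ^ 2 + v) ∧
      ∫⁻ ω, ENNReal.ofReal (u ω) ∂μ
        ≤ ENNReal.ofReal (c + inner ℝ b μ[X] + C * (‖μ[X]‖ ^ 2 + v)) := by
  set q : Ω → ℝ := fun ω => c + inner ℝ b (X ω) + C * ‖X ω‖ ^ 2
  have hq (ω : Ω) : 0 ≤ q ω := (hu ω).trans (hle ω)
  have integral_q_le : ∫ ω, q ω ∂μ ≤ c + inner ℝ b μ[X] + C * (‖μ[X]‖ ^ 2 + v) := by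
    rw [integral_quadratic hX]
    gcongr
  have integrable_q : Integrable q μ :=
    ((integrable_const c).add ((hX.integrable one_le_two).const_inner b)).add
      (hX.norm.integrable_sq.const_mul C)
  refine ⟨(integral_nonneg hq).trans integral_q_le, ?_⟩
  calc ∫⁻ ω, ENNReal.ofReal (u ω) ∂μ ≤ ∫⁻ ω, ENNReal.ofReal (q ω) ∂μ :=
        lintegral_mono fun ω => ENNReal.ofReal_le_ofReal (hle ω)
    _ = ENNReal.ofReal (∫ ω, q ω ∂μ) :=
        (ofReal_integral_eq_lintegral_ofReal integrable_q (Eventually.of_forall hq)).symm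
    _ ≤ _ := ENNReal.ofReal_le_ofReal integral_q_le

variable {n d M : ℕ} {Ξ : Type*} [MeasurableSpace Ξ] {p : Fin n → ℝ} {ℓ : Model d → Ξ → ℝ}
  {D : Fin n → Measure Ξ} {L σ ζ γ κ β fmin : ℝ} {W : Matrix (Fin n) (Fin n) ℝ}

/-- The assumptions on the losses and the data of the clients, for uniform influence scores. -/
structure IsUniformProblem (p : Fin n → ℝ) (ℓ : Model d → Ξ → ℝ) (D : Fin n → Measure Ξ)
    (L σ ζ : ℝ) : Prop where
  score_eq : ∀ i, p i = 1 / (n : ℝ)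
  isLoss : IsLoss ℓ D
  smoothness_nonneg : 0 ≤ L
  isSmooth : ∀ i, IsSmooth L (localObjective ℓ D i)
  unbiased : UnbiasedGradient ℓ D
  variance : BoundedVariance p ℓ D σ ζ

theorem IsUniformProblem.isSmooth_globalObjective [NeZero n]
    (hP : IsUniformProblem p ℓ D L σ ζ) : IsSmooth L (globalObjective p ℓ D) := by
  refine Swift.isSmooth_globalObjective (fun i => ?_) ?_ hP.isSmooth
  · rw [hP.score_eq]; positivity
  · simp [hP.score_eq]

theorem IsUniformProblem.gradient_eq_average (hP : IsUniformProblem p ℓ D L σ ζ) (x : Model d) :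
    ∇ (globalObjective p ℓ D) x = average fun i => ∇ (localObjective ℓ D i) x :=
  gradient_globalObjective_uniform hP.score_eq (fun i => (hP.isSmooth i).1) x

/-- Upper bound for the expectation of the Lyapunov function after an iteration from the state `x`
in which client `i` is active. -/
noncomputable def activeClientBound (M : ℕ) (p : Fin n → ℝ) (ℓ : Model d → Ξ → ℝ)
    (D : Fin n → Measure Ξ) (W : Matrix (Fin n) (Fin n) ℝ) (L σ γ fmin β : ℝ)
    (x : Fin n → Model d) (i : Fin n) : ℝ :=
  let v := drift W γ x (fun j => ∇ (localObjective ℓ D j) (x j)) i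
  potential (globalObjective p ℓ D) fmin β x
    + inner ℝ ((1 / (n : ℝ)) • ∇ (globalObjective p ℓ D) (average x)
        + (2 * β) • (x i - average x)) v
    + (L / (2 * n ^ 2) + β) * (‖v‖ ^ 2 + γ ^ 2 * (σ ^ 2 / M))

/-- Bound on the expected increase of the Lyapunov function in one iteration: the contributions of
the inter-client variance and of the sampling noise. -/
noncomputable def noiseLevel (n M : ℕ) (L κ γ σ ζ : ℝ) : ℝ :=
  11 / 2 * (L * γ ^ 2 / (n ^ 2 * κ ^ 2)) * (6 * ζ ^ 2 + σ ^ 2 / M)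

theorem noiseLevel_nonneg (hL : 0 ≤ L) : 0 ≤ noiseLevel n M L κ γ σ ζ := by
  unfold noiseLevel
  positivity

theorem IsSmallStep.noise_coeff_le [NeZero n] (hL : 0 ≤ L) (hγ : IsSmallStep n L κ γ) :
    (L / (2 * n ^ 2) + consensusWeight n L κ) * γ ^ 2
      ≤ 11 / 2 * (L * γ ^ 2 / (n ^ 2 * κ ^ 2)) := by
  have hκ0 := hγ.gap_pos
  have hn0 : (n : ℝ) ≠ 0 := NeZero.ne _
  calc (L / (2 * n ^ 2) + consensusWeight n L κ) * γ ^ 2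
      = (κ ^ 2 / 2 + 5 * κ) * (L * γ ^ 2 / (n ^ 2 * κ ^ 2)) := by
        rw [consensusWeight]; field_simp
    _ ≤ 11 / 2 * (L * γ ^ 2 / (n ^ 2 * κ ^ 2)) := by
        gcongr
        nlinarith [hγ.gap_le_one]

theorem average_activeClientBound_le (hn : 2 ≤ n) (hP : IsUniformProblem p ℓ D L σ ζ)
    (hγ : IsSmallStep n L κ γ) (hW : IsMixing κ W) (x : Fin n → Model d) :
    1 / n * ∑ i, activeClientBound M p ℓ D W L σ γ fmin (consensusWeight n L κ) x i
      ≤ potential (globalObjective p ℓ D) fmin (consensusWeight n L κ) x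
        - γ / (2 * n) * ‖∇ (globalObjective p ℓ D) (average x)‖ ^ 2
        + noiseLevel n M L κ γ σ ζ := by
  have : NeZero n := ⟨by omega⟩
  have change_le := average_change_le (x := x) (W := W)
    (g := fun i => ∇ (localObjective ℓ D i) (x i))
    (h := fun i => ∇ (localObjective ℓ D i) (average x)) (ζ := ζ) hn hP.smoothness_nonneg hγ hW
    (fun i => (hP.isSmooth i).2 _ _)
    (by simpa only [hP.score_eq, ← Finset.mul_sum, hP.gradient_eq_average]
      using hP.variance.inter (average x))
  have sampling_le := mul_le_mul_of_nonneg_right (hγ.noise_coeff_le hP.smoothness_nonneg)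
    (by positivity : 0 ≤ σ ^ 2 / M)
  set f := globalObjective p ℓ D
  set β := consensusWeight n L κ
  set v := drift W γ x fun i => ∇ (localObjective ℓ D i) (x i)
  have split_noise : 1 / n * ∑ i, activeClientBound M p ℓ D W L σ γ fmin β x i
      = potential f fmin β x + (L / (2 * n ^ 2) + β) * γ ^ 2 * (σ ^ 2 / M)
        + 1 / n * ∑ i, (inner ℝ ((1 / (n : ℝ)) • ∇ f (average x)
          + (2 * β) • (x i - average x)) (v i) + (L / (2 * n ^ 2) + β) * ‖v i‖ ^ 2) := by
    have hn0 : (n : ℝ) ≠ 0 := NeZero.ne _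
    simp only [activeClientBound, mul_add, Finset.sum_add_distrib, Finset.sum_const,
      Finset.card_univ, Fintype.card_fin, nsmul_eq_mul]
    field_simp
    ring
  rw [split_noise, noiseLevel]
  rw [← hP.gradient_eq_average] at change_le
  linarith

variable [∀ i, IsProbabilityMeasure (D i)]

theorem memLp_lossGradient (hunb : UnbiasedGradient ℓ D) (hvar : BoundedVariance p ℓ D σ ζ)
    (i : Fin n) (y : Model d) : MemLp (lossGradient ℓ y) 2 (D i) := by
  have noise_memLp : MemLp (fun ξ => ∇ (localObjective ℓ D i) y - lossGradient ℓ y ξ) 2 (D i) :=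
    (memLp_two_iff_integrable_sq_norm (aestronglyMeasurable_const.sub (hunb i y).1.1)).2
      (hvar.intra_integrable i y)
  refine ((memLp_const (∇ (localObjective ℓ D i) y)).sub noise_memLp).congr_norm (hunb i y).1.1 ?_
  exact Eventually.of_forall fun ξ => by rw [Pi.sub_apply, sub_sub_cancel]

theorem memLp_displacement (hunb : UnbiasedGradient ℓ D) (hvar : BoundedVariance p ℓ D σ ζ)
    (x : Fin n → Model d) (i : Fin n) :
    MemLp (displacement (M := M) ℓ W γ x i) 2 (Measure.pi fun _ => D i) :=
  (memLp_const _).sub ((memLp_sampleMean (memLp_lossGradient hunb hvar i (x i))).const_smul γ)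

variable [NeZero M]

theorem integral_displacement (hunb : UnbiasedGradient ℓ D) (hvar : BoundedVariance p ℓ D σ ζ)
    (x : Fin n → Model d) (i : Fin n) :
    ∫ ξ : Fin M → Ξ, displacement ℓ W γ x i ξ ∂(Measure.pi fun _ => D i)
      = drift W γ x (fun j => ∇ (localObjective ℓ D j) (x j)) i := by
  have integrable_batch : Integrable (fun ξ : Fin M → Ξ =>
      γ • (1 / (M : ℝ)) • ∑ m, lossGradient ℓ (x i) (ξ m)) (Measure.pi fun _ => D i) :=
    ((memLp_sampleMean (memLp_lossGradient hunb hvar i (x i))).integrable one_le_two).smul γ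
  simp only [displacement, batchGradient]
  rw [integral_sub (integrable_const _) integrable_batch,
    integral_smul, integral_sampleMean (hunb i (x i)).1, (hunb i (x i)).2]
  simp [drift]

theorem integral_norm_sq_displacement_sub_le (hunb : UnbiasedGradient ℓ D)
    (hvar : BoundedVariance p ℓ D σ ζ) (x : Fin n → Model d) (i : Fin n) :
    ∫ ξ : Fin M → Ξ, ‖displacement ℓ W γ x i ξ
        - drift W γ x (fun j => ∇ (localObjective ℓ D j) (x j)) i‖ ^ 2 ∂(Measure.pi fun _ => D i)
      ≤ γ ^ 2 * (σ ^ 2 / M) := by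
  have centred (ξ : Fin M → Ξ) : ‖displacement ℓ W γ x i ξ
        - drift W γ x (fun j => ∇ (localObjective ℓ D j) (x j)) i‖ ^ 2
      = γ ^ 2 * ‖(1 / (M : ℝ)) • ∑ m, lossGradient ℓ (x i) (ξ m)
          - ∫ ξ, lossGradient ℓ (x i) ξ ∂(D i)‖ ^ 2 := by
    rw [displacement, drift, batchGradient, sub_sub_sub_cancel_left, ← smul_sub, norm_smul, mul_pow,
      Real.norm_eq_abs, sq_abs, norm_sub_rev, (hunb i (x i)).2]
  simp only [centred]
  rw [integral_const_mul, integral_norm_sq_sampleMean_sub (memLp_lossGradient hunb hvar i (x i)),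
    (hunb i (x i)).2]
  simp only [norm_sub_rev (lossGradient ℓ (x i) _)]
  gcongr
  exact hvar.intra i (x i)

theorem lintegral_potential_averagedStep_active_le [NeZero n] (hP : IsUniformProblem p ℓ D L σ ζ)
    (hβ : 0 ≤ β) (hfmin : ∀ y, fmin ≤ globalObjective p ℓ D y) (x : Fin n → Model d) (i : Fin n) :
    0 ≤ activeClientBound M p ℓ D W L σ γ fmin β x i ∧
      ∫⁻ ξ, ENNReal.ofReal (potential (globalObjective p ℓ D) fmin β
          (averagedStep ℓ W γ x (i, ξ))) ∂(Measure.pi fun _ : Fin M => D i)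
        ≤ ENNReal.ofReal (activeClientBound M p ℓ D W L σ γ fmin β x i) := by
  have hL := hP.smoothness_nonneg
  have mean_eq := integral_displacement (M := M) (W := W) (γ := γ) hP.unbiased hP.variance x i
  have variance_le :=
    integral_norm_sq_displacement_sub_le (M := M) (W := W) (γ := γ) hP.unbiased hP.variance x i
  rw [activeClientBound, ← mean_eq]
  rw [← mean_eq] at variance_le
  refine lintegral_ofReal_le_of_le_quadratic (memLp_displacement hP.unbiased hP.variance x i)
    (fun ξ => potential_nonneg hfmin hβ _) (by positivity) (fun ξ => ?_) variance_le
  rw [averagedStep_eq_update_displacement]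
  exact potential_update_le hβ hP.isSmooth_globalObjective x i _

theorem lintegral_potential_averagedStep_le (hn : 2 ≤ n) (hP : IsUniformProblem p ℓ D L σ ζ)
    (hγ : IsSmallStep n L κ γ) (hW : IsMixing κ W) (hfmin : ∀ y, fmin ≤ globalObjective p ℓ D y)
    (x : Fin n → Model d) :
    ∫⁻ z, ENNReal.ofReal (potential (globalObjective p ℓ D) fmin (consensusWeight n L κ)
          (averagedStep ℓ W γ x z)) ∂(stepLaw M p D)
        + ENNReal.ofReal (γ / (2 * n) * ‖∇ (globalObjective p ℓ D) (average x)‖ ^ 2)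
      ≤ ENNReal.ofReal (potential (globalObjective p ℓ D) fmin (consensusWeight n L κ) x)
        + ENNReal.ofReal (noiseLevel n M L κ γ σ ζ) := by
  have : NeZero n := ⟨by omega⟩
  have hγ0 := hγ.nonneg
  set β := consensusWeight n L κ
  have hβ : 0 ≤ β := consensusWeight_nonneg hP.smoothness_nonneg hγ.gap_pos.le
  have active_le := lintegral_potential_averagedStep_active_le (M := M) (W := W) (γ := γ) hP hβ
    hfmin x
  have measurable_next : Measurable fun z : Fin n × (Fin M → Ξ) =>
      ENNReal.ofReal (potential (globalObjective p ℓ D) fmin β (averagedStep ℓ W γ x z)) :=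
    ((measurable_potential hP.isSmooth_globalObjective.1.continuous.measurable fmin β).comp
      (hP.isLoss.measurable_averagedStep W γ).of_uncurry_left).ennreal_ofReal
  have expected_le : ∫⁻ z, ENNReal.ofReal (potential (globalObjective p ℓ D) fmin β
        (averagedStep ℓ W γ x z)) ∂(stepLaw M p D)
      ≤ ENNReal.ofReal (1 / n * ∑ i, activeClientBound M p ℓ D W L σ γ fmin β x i) := by
    rw [lintegral_stepLaw p D measurable_next, Finset.mul_sum, ENNReal.ofReal_sum_of_nonneg
      fun i _ => mul_nonneg (by positivity) (active_le i).1]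
    refine Finset.sum_le_sum fun i _ => ?_
    rw [ENNReal.ofReal_mul (by positivity), hP.score_eq]
    exact mul_le_mul_right (active_le i).2 _
  calc _ ≤ ENNReal.ofReal (1 / n * ∑ i, activeClientBound M p ℓ D W L σ γ fmin β x i)
          + ENNReal.ofReal (γ / (2 * n) * ‖∇ (globalObjective p ℓ D) (average x)‖ ^ 2) := by gcongr
    _ = ENNReal.ofReal (1 / n * ∑ i, activeClientBound M p ℓ D W L σ γ fmin β x i
          + γ / (2 * n) * ‖∇ (globalObjective p ℓ D) (average x)‖ ^ 2) := by
      rw [ENNReal.ofReal_add _ (by positivity)]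
      exact mul_nonneg (by positivity) (Finset.sum_nonneg fun i _ => (active_le i).1)
    _ ≤ ENNReal.ofReal (potential (globalObjective p ℓ D) fmin β x
          + noiseLevel n M L κ γ σ ζ) := by
      refine ENNReal.ofReal_le_ofReal ?_
      linarith [average_activeClientBound_le (M := M) (fmin := fmin) hn hP hγ hW x]
    _ = _ := ENNReal.ofReal_add (potential_nonneg hfmin hβ x)
        (noiseLevel_nonneg hP.smoothness_nonneg)

end ExpectedDecrease

section ExpectedGradients

theorem integrable_and_sum_integral_le_of_sum_lintegral_le {Ω : Type*} [MeasurableSpace Ω]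
    {μ : Measure Ω} {T : ℕ} {u : ℕ → Ω → ℝ} {C : ℝ} (hu : ∀ t < T, Measurable (u t))
    (hu0 : ∀ t ω, 0 ≤ u t ω) (hC : 0 ≤ C)
    (hle : ∑ t ∈ Finset.range T, ∫⁻ ω, ENNReal.ofReal (u t ω) ∂μ ≤ ENNReal.ofReal C) :
    (∀ t < T, Integrable (u t) μ) ∧ ∑ t ∈ Finset.range T, ∫ ω, u t ω ∂μ ≤ C := by
  have hint (t : ℕ) (ht : t < T) : Integrable (u t) μ := by
    refine ⟨(hu t ht).aestronglyMeasurable, ?_⟩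
    rw [hasFiniteIntegral_iff_ofReal (Eventually.of_forall (hu0 t))]
    refine (Finset.single_le_sum (f := fun t => ∫⁻ ω, ENNReal.ofReal (u t ω) ∂μ)
      (fun _ _ => zero_le) (Finset.mem_range.2 ht)).trans_lt ?_
    exact hle.trans_lt ENNReal.ofReal_lt_top
  refine ⟨hint, (ENNReal.ofReal_le_ofReal_iff hC).1 (hle.trans_eq' ?_)⟩
  rw [ENNReal.ofReal_sum_of_nonneg fun t _ => integral_nonneg (hu0 t)]
  exact Finset.sum_congr rfl fun t ht => (ofReal_integral_eq_lintegral_ofReal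
    (hint t (Finset.mem_range.1 ht)) (Eventually.of_forall (hu0 t))).symm

variable {n d M T : ℕ} {Ξ Ω : Type*} [MeasurableSpace Ξ] [MeasurableSpace Ω] {μ : Measure Ω}
  {p : Fin n → ℝ} {ℓ : Model d → Ξ → ℝ} {D : Fin n → Measure Ξ} {L σ ζ γ κ fmin : ℝ}
  {W : ℕ → Matrix (Fin n) (Fin n) ℝ} {act : ℕ → Ω → Fin n} {data : ℕ → Ω → Fin M → Ξ}

theorem IsSampling.measurable_pair (h : IsSampling μ p D act data) (t : ℕ) :
    Measurable fun ω => (act t ω, data t ω) :=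
  (h.measurable_act t).prodMk (h.measurable_data t)

variable [IsProbabilityMeasure μ] [∀ i, IsProbabilityMeasure (D i)] [NeZero M]

theorem sum_lintegral_gradient_le (hn : 2 ≤ n) (hP : IsUniformProblem p ℓ D L σ ζ)
    (hγ : IsSmallStep n L κ γ) (hW : ∀ t < T, IsMixing κ (W t))
    (hfmin : ∀ y, fmin ≤ globalObjective p ℓ D y) (hsamp : IsSampling μ p D act data)
    (x0 : Model d) :
    ∑ t ∈ Finset.range T, ∫⁻ ω, ENNReal.ofReal (γ / (2 * n) * ‖∇ (globalObjective p ℓ D)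
        (average (iterates (fun t => averagedStep ℓ (W t) γ) (fun _ => x0)
          (fun k => (act k ω, data k ω)) t))‖ ^ 2) ∂μ
      ≤ ENNReal.ofReal (globalObjective p ℓ D x0 - fmin + T * noiseLevel n M L κ γ σ ζ) := by
  have : NeZero n := ⟨by omega⟩
  have hf := hP.isSmooth_globalObjective
  have noise_nonneg : 0 ≤ noiseLevel n M L κ γ σ ζ := noiseLevel_nonneg hP.smoothness_nonneg
  have descent := lintegral_iterates_add_sum_le (s0 := fun _ => x0) (T := T)
    (fun t => hP.isLoss.measurable_averagedStep (W t) γ) hsamp.measurable_pair hsamp.indep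
    (measurable_potential hf.1.continuous.measurable fmin (consensusWeight n L κ)).ennreal_ofReal
    (((hf.continuous_gradient.measurable.comp measurable_average).norm.pow_const 2).const_mul
      (γ / (2 * n))).ennreal_ofReal
    (fun t _ => hsamp.law t)
    (fun t ht x => lintegral_potential_averagedStep_le hn hP hγ (hW t ht) hfmin x)
  have potential_start : potential (globalObjective p ℓ D) fmin (consensusWeight n L κ)
      (fun _ : Fin n => x0) = globalObjective p ℓ D x0 - fmin := by
    rw [potential, average_const, dispersion_const, mul_zero, add_zero]
  rw [potential_start] at descent
  refine (le_add_self.trans descent).trans_eq ?_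
  rw [ENNReal.ofReal_add (sub_nonneg.2 (hfmin x0)) (by positivity),
    ENNReal.ofReal_mul (Nat.cast_nonneg T), ENNReal.ofReal_natCast]

theorem sum_integral_gradient_le (hn : 2 ≤ n) (hP : IsUniformProblem p ℓ D L σ ζ)
    (hγ : IsSmallStep n L κ γ) (hγ0 : 0 < γ) (hW : ∀ t < T, IsMixing κ (W t))
    (hfmin : ∀ y, fmin ≤ globalObjective p ℓ D y) (hsamp : IsSampling μ p D act data)
    {x0 : Model d} {xbar : ℕ → Ω → Model d}
    (hxbar : ∀ t < T, ∀ ω, xbar t ω = average (iterates (fun t => averagedStep ℓ (W t) γ)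
      (fun _ => x0) (fun k => (act k ω, data k ω)) t)) :
    (∀ t < T, Integrable (fun ω => ‖∇ (globalObjective p ℓ D) (xbar t ω)‖ ^ 2) μ) ∧
      γ / (2 * n) * ∑ t ∈ Finset.range T, ∫ ω, ‖∇ (globalObjective p ℓ D) (xbar t ω)‖ ^ 2 ∂μ
        ≤ globalObjective p ℓ D x0 - fmin + T * noiseLevel n M L κ γ σ ζ := by
  have : NeZero n := ⟨by omega⟩
  have factor_ne_zero : γ / (2 * n) ≠ 0 := by positivity
  have measurable_xbar (t : ℕ) (ht : t < T) : Measurable (xbar t) := by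
    rw [show xbar t = _ from funext (hxbar t ht)]
    exact measurable_average.comp (measurable_iterates
      (fun t => hP.isLoss.measurable_averagedStep (W t) γ) hsamp.measurable_pair t)
  have noise_nonneg : 0 ≤ noiseLevel n M L κ γ σ ζ := noiseLevel_nonneg hP.smoothness_nonneg
  obtain ⟨integrable, sum_le⟩ := integrable_and_sum_integral_le_of_sum_lintegral_le
    (μ := μ) (T := T) (u := fun t ω => γ / (2 * n) * ‖∇ (globalObjective p ℓ D) (xbar t ω)‖ ^ 2)
    (C := globalObjective p ℓ D x0 - fmin + T * noiseLevel n M L κ γ σ ζ)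
    (fun t ht => ((hP.isSmooth_globalObjective.continuous_gradient.measurable.comp
      (measurable_xbar t ht)).norm.pow_const 2).const_mul _)
    (fun t ω => by positivity)
    (add_nonneg (sub_nonneg.2 (hfmin x0)) (by positivity))
    ((Finset.sum_congr rfl fun t ht => by simp only [hxbar t (Finset.mem_range.1 ht)]).trans_le
      (sum_lintegral_gradient_le hn hP hγ hW hfmin hsamp x0))
  refine ⟨fun t ht => (integrable_const_mul_iff (isUnit_iff_ne_zero.2 factor_ne_zero) _).1
    (integrable t ht), ?_⟩
  simpa only [integral_const_mul, ← Finset.mul_sum] using sum_le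

end ExpectedGradients

section Constants

theorem nu_lt_one {n B : ℕ} (hn : 2 ≤ n) (hB : 0 < B) : nu n B < 1 := by
  have hn1 : (1 : ℝ) < n := by exact_mod_cast hn
  have inv_pow_lt_one : 1 / (n : ℝ) ^ (n * B) < 1 :=
    (div_lt_one (by positivity)).2 (one_lt_pow₀ hn1 (by positivity))
  exact Real.rpow_lt_one (sub_nonneg.2 inv_pow_lt_one.le) (sub_lt_self _ (by positivity))
    (by positivity)

theorem one_sub_inv_sq_le_nu {n B : ℕ} (hn : 2 ≤ n) (hB : 0 < B) :
    1 - 1 / (n : ℝ) ^ 2 ≤ nu n B := by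
  have hn1 : (1 : ℝ) ≤ n := by exact_mod_cast (by omega : 1 ≤ n)
  have pow_le : (n : ℝ) ^ 2 ≤ (n : ℝ) ^ (n * B) := pow_le_pow_right₀ hn1 (by nlinarith)
  have inv_pow_le_one : 1 / (n : ℝ) ^ (n * B) ≤ 1 :=
    (div_le_one (by positivity)).2 (one_le_pow₀ hn1)
  calc 1 - 1 / (n : ℝ) ^ 2 ≤ 1 - 1 / (n : ℝ) ^ (n * B) := by gcongr
    _ ≤ nu n B := Real.self_le_rpow_of_le_one (sub_nonneg.2 inv_pow_le_one)
        (sub_le_self _ (by positivity)) ((div_le_one (by positivity)).2 (by exact_mod_cast hB))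

theorem sq_card_le_connectivity_term {n B : ℕ} (hn : 2 ≤ n) (hB : 0 < B) :
    192 * (n : ℝ) ^ 2 ≤ 384 / (1 - nu n B ^ 2) := by
  have hn1 : (1 : ℝ) ≤ n := by exact_mod_cast (by omega : 1 ≤ n)
  have lt_one := nu_lt_one hn hB
  have le_nu := one_sub_inv_sq_le_nu hn hB
  have nu_nonneg : 0 ≤ nu n B :=
    (sub_nonneg.2 ((div_le_one (by positivity)).2 (one_le_pow₀ hn1))).trans le_nu
  have gap_pos : 0 < 1 - nu n B ^ 2 := by nlinarith
  have gap_le : 1 - nu n B ^ 2 ≤ 2 * (1 / (n : ℝ) ^ 2) := by nlinarith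
  rw [le_div_iff₀ gap_pos]
  calc 192 * (n : ℝ) ^ 2 * (1 - nu n B ^ 2) ≤ 192 * (n : ℝ) ^ 2 * (2 * (1 / (n : ℝ) ^ 2)) := by
        gcongr
    _ = 384 := by field_simp; norm_num

theorem inv_one_sub_sqrt_sq_le {ρ : ℝ} (hρ0 : 0 ≤ ρ) (hρ1 : ρ < 1) :
    1 / (1 - √ρ) ^ 2 ≤ 7 / (2 * (1 - ρ)) + √ρ / (1 - √ρ) ^ 2 := by
  have sq_sqrt := Real.sq_sqrt hρ0
  have gap_pos : 0 < 1 - √ρ := sub_pos.2 ((Real.sqrt_lt' one_pos).2 (by rwa [one_pow]))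
  have inv_gap_le : 1 / (1 - √ρ) ≤ 7 / (2 * (1 - ρ)) := by
    rw [div_le_div_iff₀ gap_pos (by linarith)]
    nlinarith [Real.sqrt_nonneg ρ]
  calc 1 / (1 - √ρ) ^ 2 = 1 / (1 - √ρ) + √ρ / (1 - √ρ) ^ 2 := by field_simp; ring
    _ ≤ _ := by gcongr

theorem half_mul_le_rhoNu {n B : ℕ} (hn : 2 ≤ n) (hB : 0 < B) {ρ : ℝ} (hρ0 : 0 ≤ ρ) (hρ1 : ρ < 1) :
    1 / 2 * (1 / (1 - √ρ) ^ 2 + 192 * (n : ℝ) ^ 2) ≤ rhoNu n ρ (nu n B) := by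
  have hn2 : (2 : ℝ) ≤ n := by exact_mod_cast hn
  have half_le : 1 / 2 ≤ ((n : ℝ) - 1) / n := by
    rw [div_le_div_iff₀ (by norm_num) (by linarith)]
    linarith
  have mixing_le := inv_one_sub_sqrt_sq_le hρ0 hρ1
  have connectivity_le := sq_card_le_connectivity_term hn hB
  rw [rhoNu]
  gcongr

variable {n M T : ℕ} {L Δ r ρ σ ζ κ γ S : ℝ}

theorem stepSize_eq (n M T : ℕ) (L Δ : ℝ) :
    stepSize n M T L Δ = n * √M * √Δ / (√T * √L + √M) := by
  rw [stepSize, Real.sqrt_mul (by positivity), Real.sqrt_mul (Nat.cast_nonneg M),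
    Real.sqrt_sq (Nat.cast_nonneg n), Real.sqrt_mul (Nat.cast_nonneg T), mul_comm √(M : ℝ)]

theorem stepSize_pos [NeZero n] [NeZero M] (hΔ : 0 < Δ) : 0 < stepSize n M T L Δ := by
  have hn0 : (n : ℝ) ≠ 0 := NeZero.ne _
  have hM0 : (M : ℝ) ≠ 0 := NeZero.ne _
  rw [stepSize_eq]
  positivity

theorem stepSize_mul_le [NeZero M] (hL : 0 ≤ L) (hr : 0 < r)
    (hreq : 193 ^ 2 * L * M * Δ * r ^ 2 * (n : ℝ) ^ 2 ≤ T) :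
    stepSize n M T L Δ * L ≤ 1 / (193 * r) := by
  have hM0 : (M : ℝ) ≠ 0 := NeZero.ne _
  have sqrt_req : 193 * r * n * √M * √Δ * √L ≤ √T := by
    refine (Real.sqrt_le_sqrt hreq).trans_eq' ?_
    rw [show 193 ^ 2 * L * M * Δ * r ^ 2 * (n : ℝ) ^ 2 = (193 * r * n) ^ 2 * (M * (L * Δ)) by ring,
      Real.sqrt_mul (by positivity), Real.sqrt_sq (by positivity),
      Real.sqrt_mul (Nat.cast_nonneg M), Real.sqrt_mul hL]
    ring
  rw [stepSize_eq, div_mul_eq_mul_div, div_le_div_iff₀ (by positivity) (by positivity)]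
  calc n * √M * √Δ * L * (193 * r) = 193 * r * n * √M * √Δ * √L * √L := by
        nth_rewrite 1 [← Real.mul_self_sqrt hL]; ring
    _ ≤ √T * √L := by gcongr
    _ ≤ 1 * (√T * √L + √M) := by rw [one_mul]; exact le_add_of_nonneg_right (Real.sqrt_nonneg _)

theorem isSmallStep_stepSize [NeZero M] (hn : 2 ≤ n) (hL : 0 ≤ L) (hρ1 : ρ < 1)
    (hr : 1 / 2 * (1 / (1 - √ρ) ^ 2 + 192 * (n : ℝ) ^ 2) ≤ r)
    (hreq : 193 ^ 2 * L * M * Δ * r ^ 2 * (n : ℝ) ^ 2 ≤ T) :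
    IsSmallStep n L (1 - √ρ) (stepSize n M T L Δ) := by
  have : NeZero n := ⟨by omega⟩
  have hn1 : (1 : ℝ) ≤ n := by exact_mod_cast (by omega : 1 ≤ n)
  have gap_pos : 0 < 1 - √ρ := sub_pos.2 ((Real.sqrt_lt' one_pos).2 (by rwa [one_pow]))
  have inv_gap_pos : 0 < 1 / (1 - √ρ) ^ 2 := by positivity
  have hr0 : 0 < r := lt_of_lt_of_le (by positivity) hr
  have step_le := stepSize_mul_le (n := n) (M := M) (T := T) (Δ := Δ) hL hr0 hreq
  refine ⟨by unfold stepSize; positivity, gap_pos, sub_le_self _ (Real.sqrt_nonneg ρ),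
    step_le.trans ?_, ?_⟩
  · have inv_gap_le : 1 / (1 - √ρ) ^ 2 ≤ 2 * r := by nlinarith
    rw [div_le_iff₀ (by positivity)] at inv_gap_le
    rw [div_le_div_iff₀ (by positivity) (by norm_num)]
    linarith
  · have card_le : (n : ℝ) ≤ r := by nlinarith
    calc stepSize n M T L Δ * L * n ≤ 1 / (193 * r) * r := by gcongr
      _ ≤ 1 / 2 := by field_simp; norm_num

theorem gap_div_stepSize [NeZero n] [NeZero M] (hL : 0 ≤ L) (hΔ : 0 < Δ) (hT : 0 < T) :
    2 * n * Δ / (stepSize n M T L Δ * T) = 2 * √Δ / T + 2 * √(L * Δ) / √(T * M) := by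
  have hn0 : (n : ℝ) ≠ 0 := NeZero.ne _
  have hM0 : (M : ℝ) ≠ 0 := NeZero.ne _
  rw [stepSize_eq, Real.sqrt_mul hL, Real.sqrt_mul (Nat.cast_nonneg T)]
  nth_rewrite 1 [← Real.mul_self_sqrt hΔ.le]
  nth_rewrite 2 3 [← Real.mul_self_sqrt (Nat.cast_nonneg T)]
  field_simp
  ring

theorem stepSize_mul_div_card_le [NeZero n] [NeZero M] (hL : 0 ≤ L) (hT : 0 < T) :
    L * (stepSize n M T L Δ / n) ≤ √(L * Δ) * √M / √T := by
  have hn0 : (n : ℝ) ≠ 0 := NeZero.ne _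
  have hM0 : (M : ℝ) ≠ 0 := NeZero.ne _
  have step_div : stepSize n M T L Δ / n = √M * √Δ / (√T * √L + √M) := by
    rw [stepSize_eq]; field_simp
  rw [step_div, Real.sqrt_mul hL, mul_div_assoc', div_le_div_iff₀ (by positivity) (by positivity)]
  calc L * (√M * √Δ) * √T = √L * √Δ * √M * (√T * √L) := by
        nth_rewrite 1 [← Real.mul_self_sqrt hL]; ring
    _ ≤ √L * √Δ * √M * (√T * √L + √M) := by
        gcongr
        exact le_add_of_nonneg_right (Real.sqrt_nonneg _)

theorem noiseLevel_div_stepSize_le [NeZero n] [NeZero M] (hL : 0 ≤ L) (hΔ : 0 < Δ) (hT : 0 < T)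
    (hκr : 1 / κ ^ 2 ≤ 2 * r) :
    2 * n / stepSize n M T L Δ * noiseLevel n M L κ (stepSize n M T L Δ) σ ζ
      ≤ 22 * r * √(L * Δ) * (σ ^ 2 + 6 * M * ζ ^ 2) / √(T * M) := by
  have hn0 : (n : ℝ) ≠ 0 := NeZero.ne _
  have hM0 : (M : ℝ) ≠ 0 := NeZero.ne _
  have step_pos : 0 < stepSize n M T L Δ := stepSize_pos hΔ
  have inv_gap_nonneg : 0 ≤ 1 / κ ^ 2 := by positivity
  have hr0 : 0 ≤ r := by linarith
  calc _ = 11 * (1 / κ ^ 2) * (L * (stepSize n M T L Δ / n))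
          * ((σ ^ 2 + 6 * M * ζ ^ 2) / M) := by
        rw [noiseLevel]; field_simp; ring
    _ ≤ 11 * (2 * r) * (√(L * Δ) * √M / √T) * ((σ ^ 2 + 6 * M * ζ ^ 2) / M) := by
        gcongr
        exact stepSize_mul_div_card_le hL hT
    _ = _ := by
        rw [Real.sqrt_mul (Nat.cast_nonneg T)]
        nth_rewrite 3 [← Real.mul_self_sqrt (Nat.cast_nonneg M)]
        field_simp
        ring

theorem mean_le_of_stepSize_mul_sum_le [NeZero n] [NeZero M] (hL : 0 ≤ L) (hΔ : 0 < Δ)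
    (hT : 0 < T) (hκr : 1 / κ ^ 2 ≤ 2 * r)
    (hS : stepSize n M T L Δ / (2 * n) * S
      ≤ Δ + T * noiseLevel n M L κ (stepSize n M T L Δ) σ ζ) :
    1 / (T : ℝ) * S ≤ 2 * √Δ / T
      + 2 * √(L * Δ) * (1 + 1921 / 20 * r * (σ ^ 2 + 6 * M * ζ ^ 2)) / √(T * M) := by
  have hn0 : (n : ℝ) ≠ 0 := NeZero.ne _
  have step_pos : 0 < stepSize n M T L Δ := stepSize_pos hΔ
  set γ := stepSize n M T L Δ
  have inv_gap_nonneg : 0 ≤ 1 / κ ^ 2 := by positivity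
  have hr0 : 0 ≤ r := by linarith
  calc 1 / (T : ℝ) * S = 2 * n / (γ * T) * (γ / (2 * n) * S) := by field_simp
    _ ≤ 2 * n / (γ * T) * (Δ + T * noiseLevel n M L κ γ σ ζ) := by gcongr
    _ = 2 * n * Δ / (γ * T) + 2 * n / γ * noiseLevel n M L κ γ σ ζ := by field_simp
    _ ≤ 2 * √Δ / T + 2 * √(L * Δ) / √(T * M)
          + 22 * r * √(L * Δ) * (σ ^ 2 + 6 * M * ζ ^ 2) / √(T * M) :=
        add_le_add (gap_div_stepSize hL hΔ hT).le (noiseLevel_div_stepSize_le hL hΔ hT hκr)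
    _ = 2 * √Δ / T
          + 2 * √(L * Δ) * (1 + 11 * r * (σ ^ 2 + 6 * M * ζ ^ 2)) / √(T * M) := by ring
    _ ≤ _ := by
        gcongr
        norm_num

theorem iterationRequirement_uniform {L M Δ r n : ℝ} :
    iterationRequirement L M Δ r n (1 / n) = 193 ^ 2 * L * M * Δ * r ^ 2 * n ^ 2 := by
  rw [iterationRequirement]
  rcases eq_or_ne n 0 with rfl | hn
  · simp
  · field_simp

theorem iterationRequirement_isLittleO (L M Δ r : ℝ) {A : ℕ → ℝ}
    (hA : (fun m : ℕ => (m : ℝ) ^ 4) =O[atTop] A) :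
    (fun m : ℕ => iterationRequirement L M Δ r m (1 / (m : ℝ))) =o[atTop] A := by
  have pow_isLittleO : (fun m : ℕ => (m : ℝ) ^ 2) =o[atTop] fun m : ℕ => (m : ℝ) ^ 4 :=
    (Asymptotics.isLittleO_pow_pow_atTop_of_lt (𝕜 := ℝ) (by norm_num : 2 < 4)).comp_tendsto
      tendsto_natCast_atTop_atTop
  simp only [iterationRequirement_uniform]
  exact (pow_isLittleO.trans_isBigO hA).const_mul_left _

theorem rate_le {b : ℝ} (hb : 0 ≤ b) (c : ℝ) (T M : ℕ) :
    b / T + c / √(T * M) ≤ (b + c / √M) / √T := by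
  rcases Nat.eq_zero_or_pos T with rfl | hT
  · simp
  have sqrt_le_self : √(T : ℝ) ≤ T := Real.sqrt_le_iff.2
    ⟨Nat.cast_nonneg T, le_self_pow₀ (by exact_mod_cast hT) two_ne_zero⟩
  rw [add_div, Real.sqrt_mul (Nat.cast_nonneg T), div_div, mul_comm √(M : ℝ)]
  gcongr

end Constants

section Convergence

variable {n d M s T : ℕ} {Ξ Ω : Type*} [MeasurableSpace Ξ] [MeasurableSpace Ω] {μ : Measure Ω}
  {p : Fin n → ℝ} {ℓ : Model d → Ξ → ℝ} {D : Fin n → Measure Ξ} {L σ ζ Δ fmin r ρ : ℝ}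
  {w : ℕ → Fin n → Fin n → ℝ} {act : ℕ → Ω → Fin n} {data : ℕ → Ω → Fin M → Ξ} {x0 : Model d}
  {xbar : ℕ → Ω → Model d}

theorem sum_activeCoeff_eq_one_of_symm [NeZero n] (hp : ∀ i, p i = 1 / (n : ℝ))
    {G : ℕ → SimpleGraph (Fin n)} (hw : ∀ t, IsCommWeights (G t) (w t)) {a : ℕ → Fin n} {t : ℕ}
    (hsymm : ∀ i j, p j * activeCoeff w s T a t i j = p i * activeCoeff w s T a t j i)
    (j : Fin n) : ∑ i, activeCoeff w s T a t j i = 1 := by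
  have hn0 : 1 / (n : ℝ) ≠ 0 := one_div_ne_zero (NeZero.ne _)
  simp only [hp, mul_right_inj' hn0] at hsymm
  rw [← sum_activeCoeff hw a j]
  exact Finset.sum_congr rfl fun i _ => hsymm j i

theorem isMixing_of_gramEigenvalue_activeCoeff_le (hn : 2 ≤ n) (hp : ∀ i, p i = 1 / (n : ℝ))
    {t : ℕ} (ht : t < T) (hw : IsCommWeights ⊤ (w t)) {a : ℕ → Fin n}
    (hbal : ∀ j, ∑ i, activeCoeff w 0 T a t j i = 1) (hρ0 : 0 ≤ ρ) (hρ1 : ρ < 1)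
    (hρ : gramEigenvalue (expectedCommMatrix p (activeCoeff w 0 T a t)) ⟨1, by omega⟩ ≤ ρ) :
    IsMixing (1 - √ρ) (Matrix.of (w t)) := by
  rw [activeCoeff_zero w ht] at hbal hρ
  exact isMixing_of_gramEigenvalue_le hn hp (hw.mem_doublyStochastic hbal) hw.diag hρ0 hρ1 hρ

variable [IsProbabilityMeasure μ] [∀ i, IsProbabilityMeasure (D i)] [NeZero M]

theorem mean_gradient_le_of_pos (hn : 2 ≤ n) (hP : IsUniformProblem p ℓ D L σ ζ)
    (hfmin : ∀ y, fmin ≤ globalObjective p ℓ D y) (hΔ : Δ = globalObjective p ℓ D x0 - fmin)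
    (hΔ0 : 0 < Δ) (hT : 0 < T) (hρ1 : ρ < 1)
    (hW : ∀ t < T, IsMixing (1 - √ρ) (Matrix.of (w t)))
    (hr : 1 / 2 * (1 / (1 - √ρ) ^ 2 + 192 * (n : ℝ) ^ 2) ≤ r)
    (hreq : 193 ^ 2 * L * M * Δ * r ^ 2 * (n : ℝ) ^ 2 ≤ T) (hsamp : IsSampling μ p D act data)
    (hxbar : ∀ t ω, xbar t ω = average (models ℓ w 0 T (stepSize n M T L Δ) x0
      (fun k => act k ω) (fun k => data k ω) t)) :
    (∀ t < T, Integrable (fun ω => ‖∇ (globalObjective p ℓ D) (xbar t ω)‖ ^ 2) μ) ∧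
      1 / (T : ℝ) * ∑ t ∈ Finset.range T, ∫ ω, ‖∇ (globalObjective p ℓ D) (xbar t ω)‖ ^ 2 ∂μ
        ≤ 2 * √Δ / T
          + 2 * √(L * Δ) * (1 + 1921 / 20 * r * (σ ^ 2 + 6 * M * ζ ^ 2)) / √(T * M) := by
  have : NeZero n := ⟨by omega⟩
  have small_step := isSmallStep_stepSize (M := M) hn hP.smoothness_nonneg hρ1 hr hreq
  have inv_gap_le : 1 / (1 - √ρ) ^ 2 ≤ 2 * r := by nlinarith
  obtain ⟨integrable, sum_le⟩ := sum_integral_gradient_le (x0 := x0) (xbar := xbar) hn hP small_step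
    (stepSize_pos hΔ0) hW hfmin hsamp fun t ht ω => by
      rw [hxbar, models_eq_iterates ℓ w _ x0 _ _ ht.le]
  rw [← hΔ] at sum_le
  exact ⟨integrable,
    mean_le_of_stepSize_mul_sum_le hP.smoothness_nonneg hΔ0 hT inv_gap_le sum_le⟩

theorem mean_gradient_le (hn : 2 ≤ n) (hP : IsUniformProblem p ℓ D L σ ζ)
    (hw : ∀ t, IsCommWeights ⊤ (w t))
    (hbal : ∀ t < T, ∀ a j, ∑ i, activeCoeff w s T a t j i = 1) (hρ0 : 0 ≤ ρ) (hρ1 : ρ < 1)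
    (hρ : ∀ t < T, ∀ a, gramEigenvalue (expectedCommMatrix p (activeCoeff w s T a t))
      ⟨1, by omega⟩ ≤ ρ)
    (hfmin : ∀ y, fmin ≤ globalObjective p ℓ D y) (hΔ : Δ = globalObjective p ℓ D x0 - fmin)
    (hr : 1 / 2 * (1 / (1 - √ρ) ^ 2 + 192 * (n : ℝ) ^ 2) ≤ r)
    (hreq : 193 ^ 2 * L * M * Δ * r ^ 2 * (n : ℝ) ^ 2 ≤ T) (hsamp : IsSampling μ p D act data)
    (hxbar : ∀ t ω, xbar t ω = average (models ℓ w s T (stepSize n M T L Δ) x0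
      (fun k => act k ω) (fun k => data k ω) t)) :
    (∀ t < T, Integrable (fun ω => ‖∇ (globalObjective p ℓ D) (xbar t ω)‖ ^ 2) μ) ∧
      1 / (T : ℝ) * ∑ t ∈ Finset.range T, ∫ ω, ‖∇ (globalObjective p ℓ D) (xbar t ω)‖ ^ 2 ∂μ
        ≤ 2 * √Δ / T
          + 2 * √(L * Δ) * (1 + 1921 / 20 * r * (σ ^ 2 + 6 * M * ζ ^ 2)) / √(T * M) := by
  have : NeZero n := ⟨by omega⟩
  rcases Nat.eq_zero_or_pos T with rfl | hT
  · simp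
  rcases (hΔ ▸ sub_nonneg.2 (hfmin x0) : 0 ≤ Δ).eq_or_lt with rfl | hΔ0
  · have x0_minimizes (y : Model d) : globalObjective p ℓ D x0 ≤ globalObjective p ℓ D y :=
      (sub_eq_zero.1 hΔ.symm).trans_le (hfmin y)
    have gradient_eq_zero (t : ℕ) (ω : Ω) : ∇ (globalObjective p ℓ D) (xbar t ω) = 0 := by
      rw [hxbar, stepSize_eq, Real.sqrt_zero, mul_zero, zero_div,
        models_of_stepSize_zero ℓ fun t => (hw t).sum_eq_one, average_const,
        gradient_eq_zero_of_forall_le x0_minimizes]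
    simp [gradient_eq_zero]
  · obtain rfl : s = 0 :=
      eq_zero_of_gramEigenvalue_lt_one hP.score_eq ((hρ 0 hT (fun _ => 0)).trans_lt hρ1)
    exact mean_gradient_le_of_pos hn hP hfmin hΔ hΔ0 hT hρ1
      (fun t ht => isMixing_of_gramEigenvalue_activeCoeff_le hn hP.score_eq ht (hw t)
        (hbal t ht (fun _ => 0)) hρ0 hρ1 (hρ t ht _))
      hr hreq hsamp hxbar

end Convergence

end Swift

theorem mainTheorem3_general
    {n d M s T B : ℕ} (hn : 2 ≤ n) (hM : 1 ≤ M) (hB : 0 < B)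
    {Ξ : Type*} [MeasurableSpace Ξ]
    {Ω : Type*} [MeasurableSpace Ω] (μ : Measure Ω) [IsProbabilityMeasure μ]
    (p : Fin n → ℝ) (ℓ : Swift.Model d → Ξ → ℝ) (D : Fin n → Measure Ξ)
    [∀ i, IsProbabilityMeasure (D i)]
    (L σ ζ : ℝ) (hP : Swift.IsUniformProblem p ℓ D L σ ζ)
    (w : ℕ → Fin n → Fin n → ℝ) (hw : ∀ t, Swift.IsCommWeights ⊤ (w t))
    (hbal : ∀ t < T, ∀ (a : ℕ → Fin n) (j : Fin n), ∑ i, Swift.activeCoeff w s T a t j i = 1)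
    (ρ : ℝ) (hρ0 : 0 ≤ ρ) (hρ1 : ρ < 1)
    (hρ : ∀ t < T, ∀ a : ℕ → Fin n, Swift.gramEigenvalue
      (Swift.expectedCommMatrix p (Swift.activeCoeff w s T a t)) ⟨1, by omega⟩ ≤ ρ)
    (x0 : Swift.Model d) (fmin : ℝ) (hfmin : ∀ x, fmin ≤ Swift.globalObjective p ℓ D x)
    (Δ : ℝ) (hΔ : Δ = Swift.globalObjective p ℓ D x0 - fmin)
    (r : ℝ) (hr : r = Swift.rhoNu n ρ (Swift.nu n B))
    (act : ℕ → Ω → Fin n) (data : ℕ → Ω → Fin M → Ξ)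
    (hsamp : Swift.IsSampling μ p D act data)
    (xbar : ℕ → Ω → Swift.Model d)
    (hxbar : ∀ t ω, xbar t ω = Swift.average
      (Swift.models ℓ w s T (Swift.stepSize n M T L Δ) x0
        (fun k => act k ω) (fun k => data k ω) t)) :
    (⨆ i, p i) = 1 / (n : ℝ) ∧
    Swift.iterationRequirement L M Δ r n (⨆ i, p i) = 193 ^ 2 * L * M * Δ * r ^ 2 * (n : ℝ) ^ 2 ∧
    (∀ A : ℕ → ℝ, (fun m : ℕ => (m : ℝ) ^ 4) =O[atTop] A →
      (fun m : ℕ => Swift.iterationRequirement L M Δ r m (1 / (m : ℝ))) =o[atTop] A) ∧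
    (193 ^ 2 * L * M * Δ * r ^ 2 * (n : ℝ) ^ 2 ≤ (T : ℝ) →
      (∀ t < T, Integrable
        (fun ω => ‖gradient (Swift.globalObjective p ℓ D) (xbar t ω)‖ ^ 2) μ) ∧
      (1 / (T : ℝ)) * ∑ t ∈ Finset.range T,
          ∫ ω, ‖gradient (Swift.globalObjective p ℓ D) (xbar t ω)‖ ^ 2 ∂μ
        ≤ 2 * √Δ / T
          + 2 * √(L * Δ) * (1 + 1921 / 20 * r * (σ ^ 2 + 6 * M * ζ ^ 2)) / √(T * M) ∧
      2 * √Δ / T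
          + 2 * √(L * Δ) * (1 + 1921 / 20 * r * (σ ^ 2 + 6 * M * ζ ^ 2)) / √(T * M)
        ≤ (2 * √Δ + 2 * √(L * Δ) * (1 + 1921 / 20 * r * (σ ^ 2 + 6 * M * ζ ^ 2)) / √M) / √T) := by
  have : NeZero n := ⟨by omega⟩
  have : NeZero M := ⟨by omega⟩
  have score_max : (⨆ i, p i) = 1 / (n : ℝ) := by simp only [hP.score_eq, ciSup_const]
  have r_bound := hr ▸ Swift.half_mul_le_rhoNu hn hB hρ0 hρ1
  refine ⟨score_max, by rw [score_max, Swift.iterationRequirement_uniform],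
    fun A => Swift.iterationRequirement_isLittleO L M Δ r, fun hreq => ?_⟩
  obtain ⟨integrable, mean_le⟩ := Swift.mean_gradient_le hn hP hw hbal hρ0 hρ1 hρ hfmin hΔ r_bound
    hreq hsamp hxbar
  exact ⟨integrable, mean_le, Swift.rate_le (by positivity) _ T M⟩

theorem mainTheorem3
    {n d M s T B : ℕ} (hn : 2 ≤ n) (hM : 1 ≤ M)
    {Ξ : Type*} [MeasurableSpace Ξ]
    {Ω : Type*} [MeasurableSpace Ω] (μ : Measure Ω) [IsProbabilityMeasure μ]
    -- uniform client influence scores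
    (p : Fin n → ℝ) (hp : ∀ i, p i = 1 / (n : ℝ))
    -- loss and data distributions
    (ℓ : Swift.Model d → Ξ → ℝ) (D : Fin n → Measure Ξ) [∀ i, IsProbabilityMeasure (D i)]
    (hloss : Swift.IsLoss ℓ D)
    (L σ ζ : ℝ) (hL : 0 ≤ L) (hσ : 0 ≤ σ) (hζ : 0 ≤ ζ)
    (hsmooth : ∀ i, Swift.IsSmooth L (Swift.localObjective ℓ D i))
    (hunbiased : Swift.UnbiasedGradient ℓ D)
    (hvar : Swift.BoundedVariance p ℓ D σ ζ)
    -- communication graphs and client communication coefficients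
    (G : ℕ → SimpleGraph (Fin n)) (hG : Swift.UniformlyConnected G B)
    (w : ℕ → Fin n → Fin n → ℝ) (hw : ∀ t, Swift.IsCommWeights (G t) (w t))
    (hsymm : ∀ t < T, ∀ (a : ℕ → Fin n) (i j : Fin n),
      p j * Swift.activeCoeff w s T a t i j = p i * Swift.activeCoeff w s T a t j i)
    (ρ : ℝ) (hρ0 : 0 ≤ ρ) (hρ1 : ρ < 1)
    (hρ : ∀ t < T, ∀ a : ℕ → Fin n,
      max |Swift.gramEigenvalue
            (Swift.expectedCommMatrix p (Swift.activeCoeff w s T a t)) ⟨1, by omega⟩|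
          |Swift.gramEigenvalue
            (Swift.expectedCommMatrix p (Swift.activeCoeff w s T a t)) ⟨n - 1, by omega⟩| ≤ ρ)
    -- common initial model, and a minimizer of the global objective
    (x0 xstar : Swift.Model d)
    (hxstar : ∀ x, Swift.globalObjective p ℓ D xstar ≤ Swift.globalObjective p ℓ D x)
    (Δ : ℝ) (hΔ : Δ = Swift.globalObjective p ℓ D x0 - Swift.globalObjective p ℓ D xstar)
    (r : ℝ) (hr : r = Swift.rhoNu n ρ (Swift.nu n B))
    -- random active clients and mini-batches, and the average models of SWIFT
    (act : ℕ → Ω → Fin n) (data : ℕ → Ω → Fin M → Ξ)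
    (hsamp : Swift.IsSampling μ p D act data)
    (xbar : ℕ → Ω → Swift.Model d)
    (hxbar : ∀ t ω, xbar t ω = Swift.average
      (Swift.models ℓ w s T (Swift.stepSize n M T L Δ) x0
        (fun k => act k ω) (fun k => data k ω) t)) :
    -- the iteration requirement is of order `n ^ 2`
    (⨆ i, p i) = 1 / (n : ℝ) ∧
    Swift.iterationRequirement L M Δ r n (⨆ i, p i) = 193 ^ 2 * L * M * Δ * r ^ 2 * (n : ℝ) ^ 2 ∧
    -- and thus of smaller order than any requirement of order at least `n ^ 4`
    (∀ A : ℕ → ℝ, (fun m : ℕ => (m : ℝ) ^ 4) =O[atTop] A →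
      (fun m : ℕ => Swift.iterationRequirement L M Δ r m (1 / (m : ℝ))) =o[atTop] A) ∧
    -- convergence under this requirement
    (193 ^ 2 * L * M * Δ * r ^ 2 * (n : ℝ) ^ 2 ≤ (T : ℝ) →
      (∀ t < T, Integrable
        (fun ω => ‖gradient (Swift.globalObjective p ℓ D) (xbar t ω)‖ ^ 2) μ) ∧
      (1 / (T : ℝ)) * ∑ t ∈ Finset.range T,
          ∫ ω, ‖gradient (Swift.globalObjective p ℓ D) (xbar t ω)‖ ^ 2 ∂μ
        ≤ 2 * √Δ / T
          + 2 * √(L * Δ) * (1 + 1921 / 20 * r * (σ ^ 2 + 6 * M * ζ ^ 2)) / √(T * M) ∧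
      2 * √Δ / T
          + 2 * √(L * Δ) * (1 + 1921 / 20 * r * (σ ^ 2 + 6 * M * ζ ^ 2)) / √(T * M)
        ≤ (2 * √Δ + 2 * √(L * Δ) * (1 + 1921 / 20 * r * (σ ^ 2 + 6 * M * ζ ^ 2)) / √M) / √T) := by
  have : NeZero n := ⟨by omega⟩
  exact mainTheorem3_general hn hM hG.1 μ p ℓ D L σ ζ ⟨hp, hloss, hL, hsmooth, hunbiased, hvar⟩ w
    (fun t => (hw t).mono le_top)
    (fun t ht a => Swift.sum_activeCoeff_eq_one_of_symm hp hw (hsymm t ht a)) ρ hρ0 hρ1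
    (fun t ht a => (le_abs_self _).trans ((le_max_left _ _).trans (hρ t ht a)))
    x0 _ hxstar Δ hΔ r hr act data hsamp xbar hxbar
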